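/- Work in second order arithmetic, where all sets are sets of natural numbers (relations, functions and finite sets being coded by numbers in the usual way), and let $\mathsf{ATR_0}$ be the usual axiom system of arithmetical transfinite recursion (basic axioms for $0,1,+,\cdot,<$, induction for sets, arithmetical comprehension, and transfinite recursion for arithmetical formulas along arbitrary well orders). Notation. For an infinite set $V\subseteq\mathbb N$, let $[V]^\omega$ be the collection of infinite subsets of $V$; for $X\in[V]^\omega$ put $X^-:=X\setminus\{\min X\}$. A block with base $V$ is a set $B$ of nonempty finite subsets of $V$ such that any $X\in[V]^\omega$ has exactly one initial segment in $B$. A $Q$-array $f:[V]^\omega\to Q$ is a map that is given by a function $f_0:B\to Q$ on a block $B$ with base $V$, via $f(X)=f_0(s)$ for the initial segment $s\in B$ of $X$. For a binary relation $S$ on $Q$, the array $f$ is $S$-bad if there is no $X\in[V]^\omega$ with $f(X)\,S\,f(X^-)$. For a partial order $\preceq$ on $Q$, an array $g:[W]^\omega\to Q$ is $\preceq$-minimal $S$-bad if it is $S$-bad and there is no $S$-bad array $f:[V]^\omega\to Q$ with $V\subseteq W$ such that $f(X)\prec g(X)$ holds for all $X\in[V]^\omega$. A partial ranking of a reflexive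 relation $R$ on $Q$ is a well-founded partial order $\leq'$ on $Q$ such that $p\,R\,q$ and $q\leq' r$ entail $p\,R\,r$. **Proposition.** The theory $\mathsf{ATR_0}$ proves the following (equivalently, by Gödel's completeness theorem, the following holds in every model of $\mathsf{ATR_0}$): When $\leq'$ is a partial ranking of a reflexive relation $R$ on a set $Q$, there is a well-founded partial order $\leq_Q$ on $Q$ such that 1. ${\leq'}\subseteq{\leq_Q}\subseteq R$, and 2. for any $\leq_Q$-minimal $\leq_Q$-bad array $f:[V]^\omega\to Q$, there is a set $W\in[V]^\omega$ such that the restriction of $f$ to $[W]^\omega$ is an $R$-bad array. -/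

import Mathlib

universe u

namespace SecondOrderArithmetic

/-! ### The two-sorted language of second order arithmetic and its structures -/

/-- Number terms, built from number variables `var 0`, `var 1`, … -/
inductive Tm : Type
  | var : ℕ → Tm
  | zero : Tm
  | one : Tm
  | add : Tm → Tm → Tm
  | mul : Tm → Tm → Tm

/-- Names of set variables. -/
abbrev SVar : Type := ℕ

/-- Formulas of second order arithmetic. The quantifiers `allN i`, `exN i` bind the number variable
with name `i`, and `allS k`, `exS k` bind the set variable with name `k`. Equality of sets is not
part of the language, as usual. -/
inductive Fml : Type
  | eq : Tm → Tm → Fml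
  | lt : Tm → Tm → Fml
  | mem : Tm → SVar → Fml
  | neg : Fml → Fml
  | conj : Fml → Fml → Fml
  | disj : Fml → Fml → Fml
  | impl : Fml → Fml → Fml
  | allN : ℕ → Fml → Fml
  | exN : ℕ → Fml → Fml
  | allS : SVar → Fml → Fml
  | exS : SVar → Fml → Fml

/-- A structure for the language of second order arithmetic (a Henkin structure): a nonempty domain
of numbers, which may be nonstandard, and an arbitrary nonempty collection of subsets of it, over
which the set quantifiers range. -/
structure Str : Type (u + 1) where
  num : Type u
  zero : num
  one : num
  add : num → num → num
  mul : num → num → num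
  lt : num → num → Prop
  sets : Set (Set num)
  sets_nonempty : sets.Nonempty

/-- Change the value of an assignment at one variable. -/
def assign {α : Type u} (e : ℕ → α) (i : ℕ) (a : α) : ℕ → α :=
  fun j => if j = i then a else e j

/-- The value of a term. -/
def Tm.val (M : Str.{u}) (e : ℕ → M.num) : Tm → M.num
  | .var i => e i
  | .zero => M.zero
  | .one => M.one
  | .add t v => M.add (t.val M e) (v.val M e)
  | .mul t v => M.mul (t.val M e) (v.val M e)

/-- Satisfaction of a formula under an assignment of the number and set variables. -/
def Fml.Sat (M : Str.{u}) : Fml → (ℕ → M.num) → (SVar → M.sets) → Prop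
  | .eq t v, e, _ => t.val M e = v.val M e
  | .lt t v, e, _ => M.lt (t.val M e) (v.val M e)
  | .mem t k, e, s => t.val M e ∈ (s k : Set M.num)
  | .neg φ, e, s => ¬ φ.Sat M e s
  | .conj φ ψ, e, s => φ.Sat M e s ∧ ψ.Sat M e s
  | .disj φ ψ, e, s => φ.Sat M e s ∨ ψ.Sat M e s
  | .impl φ ψ, e, s => φ.Sat M e s → ψ.Sat M e s
  | .allN i φ, e, s => ∀ a : M.num, φ.Sat M (assign e i a) s
  | .exN i φ, e, s => ∃ a : M.num, φ.Sat M (assign e i a) s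
  | .allS k φ, e, s => ∀ A : M.sets, φ.Sat M e (assign s k A)
  | .exS k φ, e, s => ∃ A : M.sets, φ.Sat M e (assign s k A)

/-- `M` satisfies the universal closure of `φ`. -/
def Str.Models (M : Str.{u}) (φ : Fml) : Prop :=
  ∀ (e : ℕ → M.num) (s : SVar → M.sets), φ.Sat M e s

/-- Logical consequence for two-sorted first order logic: every model of (the universal closures of)
the axioms in `T` is a model of `φ`. By Gödel's completeness theorem, this is the same as
provability of `φ` in the theory `T`. -/
def Entails (T : Set Fml) (φ : Fml) : Prop :=
  ∀ M : Str.{u}, (∀ ψ ∈ T, M.Models ψ) → M.Models φ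

/-- Arithmetical formulas: no set quantifiers, but free set variables are allowed. -/
def Fml.Arithmetical : Fml → Prop
  | .eq _ _ => True
  | .lt _ _ => True
  | .mem _ _ => True
  | .neg φ => φ.Arithmetical
  | .conj φ ψ => φ.Arithmetical ∧ ψ.Arithmetical
  | .disj φ ψ => φ.Arithmetical ∧ ψ.Arithmetical
  | .impl φ ψ => φ.Arithmetical ∧ ψ.Arithmetical
  | .allN _ φ => φ.Arithmetical
  | .exN _ φ => φ.Arithmetical
  | .allS _ _ => False
  | .exS _ _ => False

/-- The number variable `i` occurs in a term. -/
def Tm.OccursN (i : ℕ) : Tm → Prop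
  | .var j => j = i
  | .zero => False
  | .one => False
  | .add t v => t.OccursN i ∨ v.OccursN i
  | .mul t v => t.OccursN i ∨ v.OccursN i

/-- The number variable `i` occurs free in a formula. -/
def Fml.FreeN (i : ℕ) : Fml → Prop
  | .eq t v => t.OccursN i ∨ v.OccursN i
  | .lt t v => t.OccursN i ∨ v.OccursN i
  | .mem t _ => t.OccursN i
  | .neg φ => φ.FreeN i
  | .conj φ ψ => φ.FreeN i ∨ ψ.FreeN i
  | .disj φ ψ => φ.FreeN i ∨ ψ.FreeN i
  | .impl φ ψ => φ.FreeN i ∨ ψ.FreeN i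
  | .allN j φ => j ≠ i ∧ φ.FreeN i
  | .exN j φ => j ≠ i ∧ φ.FreeN i
  | .allS _ φ => φ.FreeN i
  | .exS _ φ => φ.FreeN i

/-- The set variable `k` occurs free in a formula. -/
def Fml.FreeS (k : SVar) : Fml → Prop
  | .eq _ _ => False
  | .lt _ _ => False
  | .mem _ l => l = k
  | .neg φ => φ.FreeS k
  | .conj φ ψ => φ.FreeS k ∨ ψ.FreeS k
  | .disj φ ψ => φ.FreeS k ∨ ψ.FreeS k
  | .impl φ ψ => φ.FreeS k ∨ ψ.FreeS k
  | .allN _ φ => φ.FreeS k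
  | .exN _ φ => φ.FreeS k
  | .allS l φ => l ≠ k ∧ φ.FreeS k
  | .exS l φ => l ≠ k ∧ φ.FreeS k

/-! ### Writing formulas

A `Bld` is a formula that still waits for a number `d` such that all variables with names `≥ d` are
fresh. A quantifier binds the variable with name `d` (which it passes to its body) and
increases `d` by one. Hence `(all fun x => φ x) d` is the formula `∀ x, φ x`, and no variable is
ever captured as long as the free variables have names below `d`. -/

abbrev Bld : Type := ℕ → Fml

def teq (t v : Tm) : Bld := fun _ => .eq t v
def tlt (t v : Tm) : Bld := fun _ => .lt t v
def mem (t : Tm) (A : SVar) : Bld := fun _ => .mem t A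
def no (φ : Bld) : Bld := fun d => .neg (φ d)
def both (φ ψ : Bld) : Bld := fun d => .conj (φ d) (ψ d)
def either (φ ψ : Bld) : Bld := fun d => .disj (φ d) (ψ d)
def imp (φ ψ : Bld) : Bld := fun d => .impl (φ d) (ψ d)
/-- number quantifiers -/
def all (φ : Tm → Bld) : Bld := fun d => .allN d (φ (.var d) (d + 1))
def ex (φ : Tm → Bld) : Bld := fun d => .exN d (φ (.var d) (d + 1))
/-- set quantifiers -/
def allSet (φ : SVar → Bld) : Bld := fun d => .allS d (φ d (d + 1))
def exSet (φ : SVar → Bld) : Bld := fun d => .exS d (φ d (d + 1))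

infixl:65 " ⊕ₜ " => Tm.add
infixl:70 " ⊙ₜ " => Tm.mul
infix:50 " ≐ " => teq
infix:50 " ⋖ₜ " => tlt
infix:50 " ∈ₛ " => mem
prefix:max "∼" => no
infixr:35 " ⩓ " => both
infixr:30 " ⩔ " => either
infixr:25 " ⟹ " => imp

def iff (φ ψ : Bld) : Bld := (φ ⟹ ψ) ⩓ (ψ ⟹ φ)

infix:20 " ⟺ " => iff

/-- The pairing function `(t, v) = (t + v)² + t`. -/
def pair (t v : Tm) : Tm := (t ⊕ₜ v) ⊙ₜ (t ⊕ₜ v) ⊕ₜ t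

/-- `(t, v) ∈ R`, for a set `R` that codes a binary relation. -/
def rel (R : SVar) (t v : Tm) : Bld := pair t v ∈ₛ R

/-- `A ⊆ B` -/
def subset (A B : SVar) : Bld := all fun x => x ∈ₛ A ⟹ x ∈ₛ B

/-! ### Orders -/

/-- `≤` is a partial order on its field `{a | a ≤ a}`. -/
def partialOrder (le : SVar) : Bld :=
  (all fun a => all fun b => rel le a b ⟹ rel le a a ⩓ rel le b b) ⩓
  (all fun a => all fun b => rel le a b ⩓ rel le b a ⟹ a ≐ b) ⩓
  (all fun a => all fun b => all fun c => rel le a b ⩓ rel le b c ⟹ rel le a c)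

/-- Any set that meets the field of `≤` has a `≤`-minimal element in the field. -/
def wellFounded (le : SVar) : Bld :=
  allSet fun A => (ex fun a => a ∈ₛ A ⩓ rel le a a) ⟹
    ex fun m => m ∈ₛ A ⩓ rel le m m ⩓ all fun a => a ∈ₛ A ⩓ rel le a m ⟹ a ≐ m

/-- `≤` is a well order on its field. -/
def wellOrder (le : SVar) : Bld :=
  partialOrder le ⩓ wellFounded le ⩓
  (all fun a => all fun b => rel le a a ⩓ rel le b b ⟹ rel le a b ⩔ rel le b a)

/-- strict part of an order -/
def strict (le : SVar) (a b : Tm) : Bld := rel le a b ⩓ ∼(a ≐ b)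

/-! ### The theory `ATR₀` -/

/-- The basic axioms on `0, 1, +, ·, <`. -/
def basicAxioms : Set Fml :=
  {(all fun m => ∼(m ⊕ₜ .one ≐ .zero)) 0,
   (all fun m => all fun n => m ⊕ₜ .one ≐ n ⊕ₜ .one ⟹ m ≐ n) 0,
   (all fun m => m ⊕ₜ .zero ≐ m) 0,
   (all fun m => all fun n => m ⊕ₜ (n ⊕ₜ .one) ≐ (m ⊕ₜ n) ⊕ₜ .one) 0,
   (all fun m => m ⊙ₜ .zero ≐ .zero) 0,
   (all fun m => all fun n => m ⊙ₜ (n ⊕ₜ .one) ≐ (m ⊙ₜ n) ⊕ₜ m) 0,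
   (all fun m => ∼(m ⋖ₜ .zero)) 0,
   (all fun m => all fun n => m ⋖ₜ n ⊕ₜ .one ⟺ (m ⋖ₜ n ⩔ m ≐ n)) 0}

/-- The induction axiom for sets. -/
def inductionAxiom : Fml :=
  (allSet fun X => .zero ∈ₛ X ⩓ (all fun n => n ∈ₛ X ⟹ n ⊕ₜ .one ∈ₛ X) ⟹
    all fun n => n ∈ₛ X) 0

/-- Comprehension for `φ(n)`: there is an `X` with `n ∈ X ↔ φ(n)` for all `n`. -/
def comprehension (φ : Fml) (n : ℕ) (X : SVar) : Fml :=
  .exS X (.allN n (((.var n ∈ₛ X) ⟺ fun _ => φ) 0))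

/-- Arithmetical comprehension. -/
def arithmeticalComprehension : Set Fml :=
  {ψ | ∃ (φ : Fml) (n : ℕ) (X : SVar), φ.Arithmetical ∧ ¬ φ.FreeS X ∧ ψ = comprehension φ n X}

/-- `Z = {(m, i) ∈ Y | i < j}`, where `<` is the strict part of `≤`. -/
def below (Z Y le : SVar) (j : Tm) : Bld :=
  all fun z => z ∈ₛ Z ⟺ (ex fun m => ex fun i => z ≐ pair m i ⩓ strict le i j ⩓ rel Y m i)

/-- Transfinite recursion for `θ(n, Z)`: if `≤` is a well order, then there is a set `Y` such that
`(n, j) ∈ Y` holds precisely if `j` is in the field of `≤` and we have `θ(n, Z)` for the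
set `Z = {(m, i) ∈ Y | i < j}`. -/
def transfiniteRecursion (θ : Fml) (n j : ℕ) (Z le Y : SVar) : Fml :=
  let d := n + j + Z + le + Y + 1
  .impl (wellOrder le d)
    (.exS Y (.allN n (.allN j
      ((rel Y (.var n) (.var j) ⟺
        (rel le (.var j) (.var j) ⩓
          fun _ => .exS Z (.conj (below Z Y le (.var j) d) θ))) d))))

/-- Arithmetical transfinite recursion. The names of the variables are arbitrary, subject to the
conditions that prevent a capture of variables. -/
def arithmeticalTransfiniteRecursion : Set Fml :=
  {ψ | ∃ (θ : Fml) (n j : ℕ) (Z le Y : SVar), θ.Arithmetical ∧ n ≠ j ∧ Z ≠ le ∧ Z ≠ Y ∧ le ≠ Y ∧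
    ¬ θ.FreeN j ∧ ¬ θ.FreeS Y ∧ ψ = transfiniteRecursion θ n j Z le Y}

/-- The axiom system `ATR₀`. -/
def ATR0 : Set Fml :=
  basicAxioms ∪ {inductionAxiom} ∪ arithmeticalComprehension ∪ arithmeticalTransfiniteRecursion

/-! ### Finite and infinite sets of numbers -/

/-- `i` is an element of the finite set coded by `s`: we have `s = (k, (m, n))` where `i < k` and
`m (i + 1) + 1` divides `n`. -/
def finMem (i s : Tm) : Bld :=
  ex fun k => ex fun m => ex fun n => s ≐ pair k (pair m n) ⩓ i ⋖ₜ k ⩓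
    ex fun c => n ≐ (m ⊙ₜ (i ⊕ₜ .one) ⊕ₜ .one) ⊙ₜ c

/-- `s` is the canonical code of a finite set: the smallest number that codes this set. -/
def finCode (s : Tm) : Bld :=
  all fun t => t ⋖ₜ s ⟹ ∼(all fun i => finMem i t ⟺ finMem i s)

/-- `X` is infinite, i.e. unbounded. -/
def infinite (X : SVar) : Bld := all fun a => ex fun b => a ⋖ₜ b ⩓ b ∈ₛ X

/-- `X ∈ [V]^ω` -/
def infSub (X V : SVar) : Bld := infinite X ⩓ subset X V

/-- The finite set coded by `s` is an initial segment of the set `X`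
(necessarily a proper one when `X` is infinite). -/
def initSeg (s : Tm) (X : SVar) : Bld :=
  ex fun b => all fun i => finMem i s ⟺ (i ∈ₛ X ⩓ i ⋖ₜ b)

/-- `Y = X⁻`, i.e. `Y` is `X` without its least element. -/
def tail (X Y : SVar) : Bld :=
  ex fun x => x ∈ₛ X ⩓ (all fun y => y ∈ₛ X ⟹ ∼(y ⋖ₜ x)) ⩓
    all fun n => n ∈ₛ Y ⟺ (n ∈ₛ X ⩓ ∼(n ≐ x))

/-! ### Blocks and arrays -/

/-- `B` is a block with base `V`: a set of (codes of) nonempty finite subsets of the infinite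
set `V` such that any `X ∈ [V]^ω` has a unique initial segment in `B`. -/
def block (B V : SVar) : Bld :=
  infinite V ⩓
  (all fun s => s ∈ₛ B ⟹
    finCode s ⩓ (ex fun i => finMem i s) ⩓ all fun i => finMem i s ⟹ i ∈ₛ V) ⩓
  (allSet fun X => infSub X V ⟹
    ex fun s => s ∈ₛ B ⩓ initSeg s X ⩓ all fun t => t ∈ₛ B ⩓ initSeg t X ⟹ t ≐ s)

/-- `f` is (the graph of) a function from `B` to `Q`. -/
def function (f B Q : SVar) : Bld :=
  (all fun z => z ∈ₛ f ⟹ ex fun s => ex fun q => z ≐ pair s q ⩓ s ∈ₛ B ⩓ q ∈ₛ Q) ⩓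
  (all fun s => s ∈ₛ B ⟹ ex fun q => rel f s q ⩓ all fun r => rel f s r ⟹ r ≐ q)

/-- `f` is a `Q`-array `[V]^ω → Q`, given as a function on a block with base `V`. -/
def array (f V Q : SVar) : Bld := exSet fun B => block B V ⩓ function f B Q

/-- `f(X) = q`, where the array `f` is given as a function on a block. -/
def value (f X : SVar) (q : Tm) : Bld := ex fun s => rel f s q ⩓ initSeg s X

/-- `f : [V]^ω → Q` is an array that is `R`-bad. -/
def badArray (f V Q R : SVar) : Bld :=
  array f V Q ⩓
  allSet fun X => allSet fun Y => infSub X V ⩓ tail X Y ⟹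
    all fun p => all fun q => value f X p ⩓ value f Y q ⟹ ∼(rel R p q)

/-- `f < g` for arrays `f` with domain `[V]^ω` and `g` with domain `[W]^ω`: we have `V ⊆ W`,
and `f(X) < g(X)` holds for all `X ∈ [V]^ω`. -/
def arrayLt (f V g W le : SVar) : Bld :=
  subset V W ⩓
  allSet fun X => infSub X V ⟹
    all fun p => all fun q => value f X p ⩓ value g X q ⟹ strict le p q

/-- `g : [W]^ω → Q` is `≤`-minimal `R`-bad. -/
def minimalBad (g W Q le R : SVar) : Bld :=
  badArray g W Q R ⩓
  ∼(exSet fun V => exSet fun f => badArray f V Q R ⩓ arrayLt f V g W le)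

/-- The array `h` with domain `[W]^ω` is the restriction of the array `f` to `[W]^ω`. -/
def restriction (h W f : SVar) : Bld :=
  allSet fun X => infSub X W ⟹ all fun q => value h X q ⟺ value f X q

/-! ### Partial rankings -/

/-- `R` is a reflexive binary relation on `Q`. -/
def reflexiveOn (R Q : SVar) : Bld :=
  (all fun z => z ∈ₛ R ⟹ ex fun p => ex fun q => z ≐ pair p q ⩓ p ∈ₛ Q ⩓ q ∈ₛ Q) ⩓
  (all fun p => p ∈ₛ Q ⟹ rel R p p)

/-- `≤` is a well-founded partial order on `Q`. -/
def wfPartialOrderOn (le Q : SVar) : Bld :=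
  reflexiveOn le Q ⩓ partialOrder le ⩓ wellFounded le

/-- `≤` is a partial ranking of the relation `R` on `Q`. -/
def partialRanking (le R Q : SVar) : Bld :=
  wfPartialOrderOn le Q ⩓
  all fun p => all fun q => all fun r => rel R p q ⩓ rel le q r ⟹ rel R p r

/-- For any partial ranking `≤'` of a reflexive relation `R` on a set `Q`, there is a well-founded
partial order `≤_Q` on `Q` with `≤' ⊆ ≤_Q ⊆ R`, such that any `≤_Q`-minimal `≤_Q`-bad array
`f : [V]^ω → Q` has an `R`-bad restriction to `[W]^ω` for some `W ∈ [V]^ω`. -/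
def pouzetSentence : Fml :=
  (allSet fun Q => allSet fun R => allSet fun le' =>
    reflexiveOn R Q ⩓ partialRanking le' R Q ⟹
      exSet fun leQ =>
        wfPartialOrderOn leQ Q ⩓ subset le' leQ ⩓ subset leQ R ⩓
        allSet fun V => allSet fun f => minimalBad f V Q leQ leQ ⟹
          exSet fun W => infSub W V ⩓
            exSet fun h => restriction h W f ⩓ badArray h W Q R) 0

end SecondOrderArithmetic

/-!
The argument takes place in an arbitrary model `M` of `ATR₀`, whose numbers may be nonstandard.

Let `L` be a well order that extends the partial ranking `≤'` (`exists_linear_extension`). By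
recursion along `L`, put `p ≤_Q q` if `p = q`, or if `p` precedes `q` in `L` and all `r ≤_Q p`
satisfy `r R q` (`exists_pouzet_order`). This is a well-founded partial order between `≤'` and `R`.
Whenever `p` precedes `q` in `L` but `p ≤_Q q` fails, there is some `r ≤_Q p` with `¬ r R q`.

Now let `f` be a `≤_Q`-minimal `≤_Q`-bad array. By the clopen Ramsey theorem (`clopen_ramsey`,
`IsArray.ramsey`), one can pass to a set on which the relation between `f(X)` and `f(X⁻)` does not
depend on `X`, as far as `R` and `L` are concerned. If we always have `f(X) R f(X⁻)` and `f(X)`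
precedes `f(X⁻)` in `L`, then badness yields values `g(X) ≤_Q f(X)` with `¬ g(X) R f(X⁻)`
(`IsArray.exists_choice`). Here `g(X) ≤_Q g(X⁻)` is impossible, since it would entail
`g(X) ≤_Q f(X⁻)` and hence `g(X) R f(X⁻)`. So `g` contradicts the minimality of `f`. It is also
impossible that `f(X⁻)` always precedes `f(X)` in `L` (`IsArray.not_descending`). In the remaining
case, a restriction of `f` is `R`-bad.

The Ramsey theorem is proved by transfinite recursion along the Kleene-Brouwer order of the tree of
undecided finite sets. It assigns a colour and an infinite set to each node `t`; the sets decrease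
modulo finite sets, and the set of `t` is almost contained in the sets of all immediate successors
of `t`. So all infinite subsets of the set of the root have the colour of the root. Both this
Kleene-Brouwer order and the order `L` are lexicographic orders of a family of sets of numbers, and
such an order is well-founded when the family has no infinite path (`isWellOrd_lexOrd`).

The preparations develop the arithmetic of `M`, closure properties of the arithmetical predicates
(`ArithPred`) and the existence of canonical codes for the bounded sets of `M` (`exists_code`).
-/

namespace SecondOrderArithmetic

/-! ### Satisfaction and comprehension -/

theorem Tm.val_congr (M : Str.{u}) {e e' : ℕ → M.num} :
    ∀ t : Tm, (∀ i, t.OccursN i → e i = e' i) → t.val M e = t.val M e'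
  | .var j, h => h j rfl
  | .zero, _ => rfl
  | .one, _ => rfl
  | .add t v, h => by
      simp only [Tm.val]
      rw [t.val_congr M fun i hi => h i (Or.inl hi), v.val_congr M fun i hi => h i (Or.inr hi)]
  | .mul t v, h => by
      simp only [Tm.val]
      rw [t.val_congr M fun i hi => h i (Or.inl hi), v.val_congr M fun i hi => h i (Or.inr hi)]

/-- Satisfaction only depends on the values of the free variables. -/
theorem Fml.sat_congr (M : Str.{u}) (φ : Fml) : ∀ {e e' : ℕ → M.num} {s s' : SVar → M.sets},
    (∀ i, φ.FreeN i → e i = e' i) → (∀ k, φ.FreeS k → s k = s' k) →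
      (φ.Sat M e s ↔ φ.Sat M e' s') := by
  induction φ with
  | eq t v =>
    intro e e' s s' h _
    simp only [Fml.Sat]
    rw [t.val_congr M fun i hi => h i (Or.inl hi), v.val_congr M fun i hi => h i (Or.inr hi)]
  | lt t v =>
    intro e e' s s' h _
    simp only [Fml.Sat]
    rw [t.val_congr M fun i hi => h i (Or.inl hi), v.val_congr M fun i hi => h i (Or.inr hi)]
  | mem t k =>
    intro e e' s s' h h'
    simp only [Fml.Sat]
    rw [t.val_congr M fun i hi => h i hi, h' k rfl]
  | neg φ ih => intro e e' s s' h h'; exact not_congr (ih h h')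
  | conj φ ψ ih1 ih2 =>
    intro e e' s s' h h'
    exact and_congr (ih1 (fun i hi => h i (Or.inl hi)) fun i hi => h' i (Or.inl hi))
      (ih2 (fun i hi => h i (Or.inr hi)) fun i hi => h' i (Or.inr hi))
  | disj φ ψ ih1 ih2 =>
    intro e e' s s' h h'
    exact or_congr (ih1 (fun i hi => h i (Or.inl hi)) fun i hi => h' i (Or.inl hi))
      (ih2 (fun i hi => h i (Or.inr hi)) fun i hi => h' i (Or.inr hi))
  | impl φ ψ ih1 ih2 =>
    intro e e' s s' h h'
    exact imp_congr (ih1 (fun i hi => h i (Or.inl hi)) fun i hi => h' i (Or.inl hi))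
      (ih2 (fun i hi => h i (Or.inr hi)) fun i hi => h' i (Or.inr hi))
  | allN j φ ih =>
    intro e e' s s' h h'
    refine forall_congr' fun a => ih (fun i hi => ?_) h'
    by_cases hij : i = j
    · simp [assign, hij]
    · simpa [assign, hij] using h i ⟨Ne.symm hij, hi⟩
  | exN j φ ih =>
    intro e e' s s' h h'
    refine exists_congr fun a => ih (fun i hi => ?_) h'
    by_cases hij : i = j
    · simp [assign, hij]
    · simpa [assign, hij] using h i ⟨Ne.symm hij, hi⟩
  | allS j φ ih =>
    intro e e' s s' h h'
    refine forall_congr' fun a => ih h fun i hi => ?_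
    by_cases hij : i = j
    · simp [assign, hij]
    · simpa [assign, hij] using h' i ⟨Ne.symm hij, hi⟩
  | exS j φ ih =>
    intro e e' s s' h h'
    refine exists_congr fun a => ih h fun i hi => ?_
    by_cases hij : i = j
    · simp [assign, hij]
    · simpa [assign, hij] using h' i ⟨Ne.symm hij, hi⟩

theorem Fml.exists_fresh (φ : Fml) : ∃ N : ℕ, ∀ k, N ≤ k → ¬ φ.FreeS k := by
  induction φ with
  | eq t v => exact ⟨0, fun k _ h => h⟩
  | lt t v => exact ⟨0, fun k _ h => h⟩
  | mem t k => exact ⟨k + 1, fun l hl (h : k = l) => absurd (h ▸ hl) (Nat.not_succ_le_self k)⟩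
  | neg φ ih => exact ih
  | conj φ ψ ih1 ih2 =>
    obtain ⟨N1, h1⟩ := ih1
    obtain ⟨N2, h2⟩ := ih2
    exact ⟨max N1 N2, fun k hk h => h.elim (h1 k (le_trans (le_max_left _ _) hk))
      (h2 k (le_trans (le_max_right _ _) hk))⟩
  | disj φ ψ ih1 ih2 =>
    obtain ⟨N1, h1⟩ := ih1
    obtain ⟨N2, h2⟩ := ih2
    exact ⟨max N1 N2, fun k hk h => h.elim (h1 k (le_trans (le_max_left _ _) hk))
      (h2 k (le_trans (le_max_right _ _) hk))⟩
  | impl φ ψ ih1 ih2 =>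
    obtain ⟨N1, h1⟩ := ih1
    obtain ⟨N2, h2⟩ := ih2
    exact ⟨max N1 N2, fun k hk h => h.elim (h1 k (le_trans (le_max_left _ _) hk))
      (h2 k (le_trans (le_max_right _ _) hk))⟩
  | allN j φ ih => exact ih
  | exN j φ ih => exact ih
  | allS j φ ih => obtain ⟨N, h⟩ := ih; exact ⟨N, fun k hk h' => h k hk h'.2⟩
  | exS j φ ih => obtain ⟨N, h⟩ := ih; exact ⟨N, fun k hk h' => h k hk h'.2⟩

/-- The structure `M` is a model of `ATR₀`. -/
class Str.IsATR (M : Str.{u}) : Prop where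
  models : ∀ ψ ∈ ATR0, M.Models ψ

/-! ### The numbers of a model -/

section Arithmetic

variable {M : Str.{u}} [hM : M.IsATR]

theorem arithmetical_mem_sets (φ : Fml) (hφ : φ.Arithmetical) (e : ℕ → M.num) (s : SVar → M.sets) :
    {a | φ.Sat M (assign e 0 a) s} ∈ M.sets := by
  obtain ⟨N, hN⟩ := φ.exists_fresh
  obtain ⟨A, hA⟩ := hM.models _ (Or.inl (Or.inr ⟨φ, 0, N, hφ, hN N le_rfl, rfl⟩)) e s
  have : (A : Set M.num) = {a | φ.Sat M (assign e 0 a) s} := by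
    ext a
    have h := hA a
    have h2 : φ.Sat M (assign e 0 a) (assign s N A) ↔ φ.Sat M (assign e 0 a) s := by
      refine φ.sat_congr M (fun _ _ => rfl) fun k hk => ?_
      have : k ≠ N := fun h => hN N le_rfl (h ▸ hk)
      simp [assign, this]
    simp only [iff, both, imp, mem, Fml.Sat, Tm.val, assign, if_true] at h
    rw [Set.mem_ofPred_eq, ← h2]
    exact ⟨h.1, h.2⟩
  rw [← this]
  exact A.2

instance : Zero M.num := ⟨M.zero⟩
instance : One M.num := ⟨M.one⟩
instance : Add M.num := ⟨M.add⟩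
instance : Mul M.num := ⟨M.mul⟩
instance : LT M.num := ⟨M.lt⟩
instance : LE M.num := ⟨fun a b => a < b ∨ a = b⟩
instance : Nonempty M.sets := M.sets_nonempty.to_subtype

theorem num_basic : ∀ ψ ∈ basicAxioms, M.Models ψ :=
  fun ψ h => hM.models ψ (Or.inl (Or.inl (Or.inl h)))

theorem Str.exists_env (M : Str.{u}) : Nonempty ((ℕ → M.num) × (SVar → M.sets)) :=
  ⟨fun _ => M.zero, fun _ => ⟨_, M.sets_nonempty.some_mem⟩⟩

theorem num_succ_ne_zero (a : M.num) : a + 1 ≠ 0 := by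
  obtain ⟨e, s⟩ := M.exists_env
  exact num_basic ((all fun m => ∼(m ⊕ₜ .one ≐ .zero)) 0) (by simp [basicAxioms]) e s a

theorem num_succ_inj {a b : M.num} : a + 1 = b + 1 → a = b := by
  obtain ⟨e, s⟩ := M.exists_env
  exact num_basic ((all fun m => all fun n => m ⊕ₜ .one ≐ n ⊕ₜ .one ⟹ m ≐ n) 0)
    (by simp [basicAxioms]) e s a b

theorem num_add_zero (a : M.num) : a + 0 = a := by
  obtain ⟨e, s⟩ := M.exists_env
  exact num_basic ((all fun m => m ⊕ₜ .zero ≐ m) 0) (by simp [basicAxioms]) e s a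

theorem num_add_succ (a b : M.num) : a + (b + 1) = (a + b) + 1 := by
  obtain ⟨e, s⟩ := M.exists_env
  exact num_basic ((all fun m => all fun n => m ⊕ₜ (n ⊕ₜ .one) ≐ (m ⊕ₜ n) ⊕ₜ .one) 0)
    (by simp [basicAxioms]) e s a b

theorem num_mul_zero (a : M.num) : a * 0 = 0 := by
  obtain ⟨e, s⟩ := M.exists_env
  exact num_basic ((all fun m => m ⊙ₜ .zero ≐ .zero) 0) (by simp [basicAxioms]) e s a

theorem num_mul_succ (a b : M.num) : a * (b + 1) = a * b + a := by
  obtain ⟨e, s⟩ := M.exists_env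
  exact num_basic ((all fun m => all fun n => m ⊙ₜ (n ⊕ₜ .one) ≐ (m ⊙ₜ n) ⊕ₜ m) 0)
    (by simp [basicAxioms]) e s a b

theorem num_not_lt_zero (a : M.num) : ¬ a < 0 := by
  obtain ⟨e, s⟩ := M.exists_env
  exact num_basic ((all fun m => ∼(m ⋖ₜ .zero)) 0) (by simp [basicAxioms]) e s a

theorem num_lt_succ {a b : M.num} : a < b + 1 ↔ a < b ∨ a = b := by
  obtain ⟨e, s⟩ := M.exists_env
  have := num_basic ((all fun m => all fun n => m ⋖ₜ n ⊕ₜ .one ⟺ (m ⋖ₜ n ⩔ m ≐ n)) 0)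
    (by simp [basicAxioms]) e s a b
  exact ⟨this.1, this.2⟩

theorem induction_of_mem_sets {A : Set M.num} (hA : A ∈ M.sets) (h0 : (0 : M.num) ∈ A)
    (h1 : ∀ a ∈ A, a + 1 ∈ A) (a : M.num) : a ∈ A := by
  obtain ⟨e, s⟩ := M.exists_env
  exact hM.models inductionAxiom (Or.inl (Or.inl (Or.inr rfl))) e s ⟨A, hA⟩ ⟨h0, h1⟩ a

/-- Induction for an arithmetical formula in the number variable `0`, with two number parameters. -/
theorem sat_induction (φ : Fml) (hφ : φ.Arithmetical) (b c : M.num) (s : SVar → M.sets)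
    (h0 : φ.Sat M (assign (fun i => if i = 1 then b else c) 0 0) s)
    (h1 : ∀ a, φ.Sat M (assign (fun i => if i = 1 then b else c) 0 a) s →
      φ.Sat M (assign (fun i => if i = 1 then b else c) 0 (a + 1)) s) (a : M.num) :
    φ.Sat M (assign (fun i => if i = 1 then b else c) 0 a) s :=
  induction_of_mem_sets (arithmetical_mem_sets φ hφ (fun i => if i = 1 then b else c) s) h0 h1 a

local notation "v0" => Tm.var 0
local notation "v1" => Tm.var 1
local notation "v2" => Tm.var 2

theorem num_zero_add (a : M.num) : 0 + a = a :=
  sat_induction ((.zero ⊕ₜ v0 ≐ v0) 0) trivial 0 0 (fun _ => Classical.arbitrary _)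
    (num_add_zero 0) (fun a (h : 0 + a = a) => show 0 + (a + 1) = a + 1 by
      rw [num_add_succ, h]) a

theorem num_add_assoc (b c a : M.num) : b + c + a = b + (c + a) :=
  sat_induction (((v1 ⊕ₜ v2) ⊕ₜ v0 ≐ v1 ⊕ₜ (v2 ⊕ₜ v0)) 0) trivial b c
    (fun _ => Classical.arbitrary _)
    (show b + c + 0 = b + (c + 0) by rw [num_add_zero, num_add_zero])
    (fun a (h : b + c + a = b + (c + a)) => show b + c + (a + 1) = b + (c + (a + 1)) by
      rw [num_add_succ, h, num_add_succ, num_add_succ]) a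

theorem num_succ_add (b a : M.num) : b + 1 + a = b + a + 1 :=
  sat_induction (((v1 ⊕ₜ .one) ⊕ₜ v0 ≐ v1 ⊕ₜ v0 ⊕ₜ .one) 0) trivial b b
    (fun _ => Classical.arbitrary _)
    (show b + 1 + 0 = b + 0 + 1 by rw [num_add_zero, num_add_zero])
    (fun a (h : b + 1 + a = b + a + 1) => show b + 1 + (a + 1) = b + (a + 1) + 1 by
      rw [num_add_succ, h, num_add_succ]) a

theorem num_add_comm (b a : M.num) : b + a = a + b :=
  sat_induction ((v1 ⊕ₜ v0 ≐ v0 ⊕ₜ v1) 0) trivial b b (fun _ => Classical.arbitrary _)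
    (show b + 0 = 0 + b by rw [num_add_zero, num_zero_add])
    (fun a (h : b + a = a + b) => show b + (a + 1) = a + 1 + b by
      rw [num_add_succ, h, num_succ_add]) a

theorem num_zero_mul (a : M.num) : 0 * a = 0 :=
  sat_induction ((.zero ⊙ₜ v0 ≐ .zero) 0) trivial 0 0 (fun _ => Classical.arbitrary _)
    (num_mul_zero 0) (fun a (h : 0 * a = 0) => show 0 * (a + 1) = 0 by
      rw [num_mul_succ, h, num_add_zero]) a

theorem num_succ_mul (b a : M.num) : (b + 1) * a = b * a + a :=
  sat_induction (((v1 ⊕ₜ .one) ⊙ₜ v0 ≐ v1 ⊙ₜ v0 ⊕ₜ v0) 0) trivial b b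
    (fun _ => Classical.arbitrary _)
    (show (b + 1) * 0 = b * 0 + 0 by rw [num_mul_zero, num_mul_zero, num_add_zero])
    (fun a (h : (b + 1) * a = b * a + a) => show (b + 1) * (a + 1) = b * (a + 1) + (a + 1) by
      rw [num_mul_succ, h, num_mul_succ, num_add_succ, num_add_succ, num_add_assoc (b * a) a b,
        num_add_assoc (b * a) b a, num_add_comm b a]) a

theorem num_mul_comm (b a : M.num) : b * a = a * b :=
  sat_induction ((v1 ⊙ₜ v0 ≐ v0 ⊙ₜ v1) 0) trivial b b (fun _ => Classical.arbitrary _)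
    (show b * 0 = 0 * b by rw [num_mul_zero, num_zero_mul])
    (fun a (h : b * a = a * b) => show b * (a + 1) = (a + 1) * b by
      rw [num_mul_succ, h, num_succ_mul]) a

theorem num_mul_add (b c a : M.num) : b * (c + a) = b * c + b * a :=
  sat_induction ((v1 ⊙ₜ (v2 ⊕ₜ v0) ≐ v1 ⊙ₜ v2 ⊕ₜ v1 ⊙ₜ v0) 0) trivial b c
    (fun _ => Classical.arbitrary _)
    (show b * (c + 0) = b * c + b * 0 by rw [num_add_zero, num_mul_zero, num_add_zero])
    (fun a (h : b * (c + a) = b * c + b * a) => show b * (c + (a + 1)) = b * c + b * (a + 1) by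
      rw [num_add_succ, num_mul_succ, h, num_mul_succ, num_add_assoc]) a

theorem num_mul_assoc (b c a : M.num) : b * c * a = b * (c * a) :=
  sat_induction (((v1 ⊙ₜ v2) ⊙ₜ v0 ≐ v1 ⊙ₜ (v2 ⊙ₜ v0)) 0) trivial b c
    (fun _ => Classical.arbitrary _)
    (show b * c * 0 = b * (c * 0) by rw [num_mul_zero, num_mul_zero, num_mul_zero])
    (fun a (h : b * c * a = b * (c * a)) => show b * c * (a + 1) = b * (c * (a + 1)) by
      rw [num_mul_succ, h, num_mul_succ, num_mul_add]) a

theorem num_one_mul (a : M.num) : 1 * a = a := by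
  have : (1 : M.num) = 0 + 1 := (num_zero_add 1).symm
  rw [this, num_succ_mul, num_zero_mul, num_zero_add]

instance : CommSemiring M.num where
  add_assoc := num_add_assoc
  zero_add := num_zero_add
  add_zero := num_add_zero
  add_comm := num_add_comm
  left_distrib := num_mul_add
  right_distrib a b c := by rw [num_mul_comm, num_mul_add, num_mul_comm c, num_mul_comm c]
  zero_mul := num_zero_mul
  mul_zero := num_mul_zero
  mul_assoc := num_mul_assoc
  mul_comm := num_mul_comm
  one_mul := num_one_mul
  mul_one a := by rw [num_mul_comm, num_one_mul]
  nsmul := nsmulRec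
  npow := npowRec

theorem num_add_right_cancel {a b c : M.num} : a + c = b + c → a = b :=
  sat_induction ((v1 ⊕ₜ v0 ≐ v2 ⊕ₜ v0 ⟹ v1 ≐ v2) 0) ⟨trivial, trivial⟩ a b
    (fun _ => Classical.arbitrary _)
    (show a + 0 = b + 0 → a = b by simp)
    (fun c (h : a + c = b + c → a = b) => show a + (c + 1) = b + (c + 1) → a = b by
      rw [num_add_succ, num_add_succ]; exact fun h' => h (num_succ_inj h')) c

/-- Every number is zero or a successor. -/
theorem num_zero_or_succ (a : M.num) : a = 0 ∨ ∃ b, a = b + 1 :=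
  sat_induction ((v0 ≐ .zero ⩔ ex fun b => v0 ≐ b ⊕ₜ .one) 1) ⟨trivial, trivial⟩ 0 0
    (fun _ => Classical.arbitrary _) (Or.inl rfl) (fun a _ => Or.inr ⟨a, rfl⟩) a

theorem num_lt_iff {a b : M.num} : a < b ↔ ∃ c, a + c + 1 = b := by
  constructor
  · refine sat_induction ((v1 ⋖ₜ v0 ⟹ ex fun c => v1 ⊕ₜ c ⊕ₜ .one ≐ v0) 2)
      ⟨trivial, trivial⟩ a a (fun _ => Classical.arbitrary _)
      (fun h => (num_not_lt_zero _ h).elim) ?_ b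
    intro b (h : a < b → ∃ c, a + c + 1 = b)
    change a < b + 1 → ∃ c, a + c + 1 = b + 1
    intro hab
    rcases num_lt_succ.1 hab with hab | rfl
    · obtain ⟨c, rfl⟩ := h hab
      exact ⟨c + 1, by ring⟩
    · exact ⟨0, by ring⟩
  · rintro ⟨c, rfl⟩
    refine sat_induction ((v1 ⋖ₜ v1 ⊕ₜ v0 ⊕ₜ .one) 2)
      trivial a a (fun _ => Classical.arbitrary _) ?_ ?_ c
    · exact num_lt_succ.2 (Or.inr (num_add_zero a).symm)
    · intro c (h : a < a + c + 1)
      change a < a + (c + 1) + 1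
      rw [← add_assoc]
      exact num_lt_succ.2 (Or.inl h)

theorem num_le_iff {a b : M.num} : a ≤ b ↔ ∃ c, b = a + c := by
  change (a < b ∨ a = b) ↔ _
  rw [num_lt_iff]
  constructor
  · rintro (⟨c, rfl⟩ | rfl)
    · exact ⟨c + 1, by ring⟩
    · exact ⟨0, by ring⟩
  · rintro ⟨c, rfl⟩
    rcases num_zero_or_succ c with rfl | ⟨d, rfl⟩
    · right; ring
    · left; exact ⟨d, by ring⟩

theorem num_lt_irrefl (a : M.num) : ¬ a < a := by
  rw [num_lt_iff]
  rintro ⟨c, h⟩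
  have : c + 1 + a = 0 + a := by rw [zero_add]; conv_rhs => rw [← h]
                                 ring
  exact num_succ_ne_zero _ (num_add_right_cancel this)

theorem num_lt_trans {a b c : M.num} (h : a < b) (h' : b < c) : a < c := by
  rw [num_lt_iff] at *
  obtain ⟨x, rfl⟩ := h
  obtain ⟨y, rfl⟩ := h'
  exact ⟨x + y + 1, by ring⟩

theorem num_lt_trichotomy (a b : M.num) : a < b ∨ a = b ∨ b < a := by
  refine sat_induction ((v0 ⋖ₜ v1 ⩔ v0 ≐ v1 ⩔ v1 ⋖ₜ v0) 2)
    ⟨trivial, trivial, trivial⟩ b b (fun _ => Classical.arbitrary _) ?_ ?_ a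
  · change 0 < b ∨ 0 = b ∨ b < 0
    rcases num_zero_or_succ b with rfl | ⟨d, rfl⟩
    · simp
    · left; exact num_lt_iff.2 ⟨d, by ring⟩
  · intro a (h : a < b ∨ a = b ∨ b < a)
    change a + 1 < b ∨ a + 1 = b ∨ b < a + 1
    rcases h with h | h | h
    · obtain ⟨c, rfl⟩ := num_lt_iff.1 h
      rcases num_zero_or_succ c with rfl | ⟨d, rfl⟩
      · right; left; ring
      · left; exact num_lt_iff.2 ⟨d, by ring⟩
    · right; right; exact num_lt_succ.2 (Or.inr h.symm)
    · right; right; exact num_lt_succ.2 (Or.inl h)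

noncomputable instance : LinearOrder M.num where
  le_refl a := Or.inr rfl
  le_trans a b c h h' := by
    rcases h with h | rfl
    · rcases h' with h' | rfl
      · exact Or.inl (num_lt_trans h h')
      · exact Or.inl h
    · exact h'
  lt_iff_le_not_ge a b := by
    constructor
    · intro h
      refine ⟨Or.inl h, ?_⟩
      rintro (h' | rfl)
      · exact num_lt_irrefl _ (num_lt_trans h h')
      · exact num_lt_irrefl _ h
    · rintro ⟨h | rfl, h'⟩
      · exact h
      · exact (h' (Or.inr rfl)).elim
  le_antisymm a b h h' := by
    rcases h with h | rfl
    · rcases h' with h' | rfl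
      · exact (num_lt_irrefl _ (num_lt_trans h h')).elim
      · rfl
    · rfl
  le_total a b := by
    rcases num_lt_trichotomy a b with h | h | h
    · exact Or.inl (Or.inl h)
    · exact Or.inl (Or.inr h)
    · exact Or.inr (Or.inl h)
  toDecidableLE := Classical.decRel _

instance : IsOrderedCancelAddMonoid M.num where
  add_le_add_left a b h c := by
    obtain ⟨d, rfl⟩ := num_le_iff.1 h
    exact num_le_iff.2 ⟨d, by ring⟩
  le_of_add_le_add_left a b c h := by
    obtain ⟨d, hd⟩ := num_le_iff.1 h
    refine num_le_iff.2 ⟨d, num_add_right_cancel (c := a) ?_⟩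
    rw [add_comm, hd]; ring

instance : CanonicallyOrderedAdd M.num where
  le_self_add _ b := num_le_iff.2 ⟨b, rfl⟩
  le_add_self _ b := num_le_iff.2 ⟨b, add_comm _ _⟩
  exists_add_of_le h := num_le_iff.1 h

theorem lt_succ_iff {a b : M.num} : a < b + 1 ↔ a ≤ b := num_lt_succ

theorem succ_le_iff' {a b : M.num} : a + 1 ≤ b ↔ a < b := by
  rw [num_lt_iff, num_le_iff]
  exact exists_congr fun c => by rw [eq_comm]; ring_nf

end Arithmetic

/-! ### Arithmetical predicates and functions -/

section Definability

variable {M : Str.{u}} [hM : M.IsATR]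

/-- The pairing function of the structure `M`. -/
def pr (a b : M.num) : M.num := (a + b) * (a + b) + a

theorem pr_sum_le {a b c d : M.num} (h : pr a b = pr c d) : c + d ≤ a + b := by
  by_contra hlt
  have h1 : a + b + 1 ≤ c + d := succ_le_iff'.2 (not_le.1 hlt)
  have h2 : (a + b + 1) * (a + b + 1) ≤ (c + d) * (c + d) := mul_le_mul' h1 h1
  have h3 : pr a b + (a + b + b + 1) = (a + b + 1) * (a + b + 1) := by unfold pr; ring
  have h4 : (c + d) * (c + d) ≤ pr c d := le_self_add
  have h5 : pr a b + (a + b + b + 1) ≤ pr a b := by rw [h3]; exact (h2.trans h4).trans h.ge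
  have h6 : pr a b < pr a b + (a + b + b + 1) := num_lt_iff.2 ⟨a + b + b, by ring⟩
  exact absurd h5 (not_le.2 h6)

theorem pr_inj {a b c d : M.num} : pr a b = pr c d ↔ a = c ∧ b = d := by
  refine ⟨fun h => ?_, fun h => by rw [h.1, h.2]⟩
  have hs : a + b = c + d := le_antisymm (pr_sum_le h.symm) (pr_sum_le h)
  have hac : a = c := by
    unfold pr at h
    rw [hs] at h
    exact add_left_cancel h
  subst hac
  exact ⟨rfl, add_left_cancel hs⟩

open Classical in
/-- The first component of a pair, with value `0` outside the range of the pairing function. -/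
noncomputable def fst (z : M.num) : M.num := if h : ∃ a b, z = pr a b then h.choose else 0

open Classical in
/-- The second component of a pair, with value `0` outside the range of the pairing function. -/
noncomputable def snd (z : M.num) : M.num :=
  if h : ∃ a b, z = pr a b then h.choose_spec.choose else 0

@[simp] theorem fst_pr (a b : M.num) : fst (pr a b) = a := by
  have h : ∃ c d, pr a b = pr c d := ⟨a, b, rfl⟩
  unfold fst
  rw [dif_pos h]
  exact (pr_inj.1 h.choose_spec.choose_spec).1.symm

@[simp] theorem snd_pr (a b : M.num) : snd (pr a b) = b := by
  have h : ∃ c d, pr a b = pr c d := ⟨a, b, rfl⟩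
  unfold snd
  rw [dif_pos h]
  exact (pr_inj.1 h.choose_spec.choose_spec).2.symm

/-- A predicate on the numbers of `M` is arithmetical if its extension belongs to `M`. By
arithmetical comprehension, the class of these predicates is closed under first order definitions.
A predicate of several variables is treated as a predicate of an iterated pair. -/
class ArithPred (P : M.num → Prop) : Prop where
  mem : {x | P x} ∈ M.sets

/-- The graph of a function on numbers. -/
def graph (t : M.num → M.num) : Set M.num := {z | ∃ x, z = pr x (t x)}

/-- A function on the numbers of `M` is arithmetical if its graph belongs to `M`. -/
class ArithFun (t : M.num → M.num) : Prop where
  mem : graph t ∈ M.sets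

theorem pr_mem_graph {t : M.num → M.num} {x y : M.num} : pr x y ∈ graph t ↔ y = t x := by
  constructor
  · rintro ⟨x', h⟩
    obtain ⟨rfl, rfl⟩ := pr_inj.1 h
    rfl
  · rintro rfl
    exact ⟨x, rfl⟩

/-- Comprehension for a formula in the number variable `0`, with a number parameter `1` and set
parameters `0` and `1`. -/
theorem setOf_mem_sets {P : M.num → Prop} (φ : Fml) (hφ : φ.Arithmetical) (c : M.num) (A B : M.sets)
    (h : ∀ a, φ.Sat M (assign (fun _ => c) 0 a) (fun k => if k = 0 then A else B) ↔ P a) :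
    {a | P a} ∈ M.sets := by
  have := arithmetical_mem_sets φ hφ (fun _ => c) (fun k => if k = 0 then A else B)
  rwa [show {a | P a} = _ from Set.ext fun a => (h a).symm]

local notation "v0" => Tm.var 0
local notation "v1" => Tm.var 1

instance ArithPred.not {P : M.num → Prop} [h : ArithPred P] : ArithPred fun x => ¬ P x :=
  ⟨setOf_mem_sets ((∼(v0 ∈ₛ 0)) 1) trivial 0 ⟨_, h.mem⟩ ⟨_, h.mem⟩ fun _ => Iff.rfl⟩

instance ArithPred.and {P Q : M.num → Prop} [h : ArithPred P] [h' : ArithPred Q] :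
    ArithPred fun x => P x ∧ Q x :=
  ⟨setOf_mem_sets ((v0 ∈ₛ 0 ⩓ v0 ∈ₛ 1) 1) ⟨trivial, trivial⟩ 0 ⟨_, h.mem⟩ ⟨_, h'.mem⟩
    fun _ => Iff.rfl⟩

instance ArithPred.or {P Q : M.num → Prop} [h : ArithPred P] [h' : ArithPred Q] :
    ArithPred fun x => P x ∨ Q x :=
  ⟨setOf_mem_sets ((v0 ∈ₛ 0 ⩔ v0 ∈ₛ 1) 1) ⟨trivial, trivial⟩ 0 ⟨_, h.mem⟩ ⟨_, h'.mem⟩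
    fun _ => Iff.rfl⟩

instance ArithPred.imp {P Q : M.num → Prop} [h : ArithPred P] [h' : ArithPred Q] :
    ArithPred fun x => P x → Q x :=
  ⟨setOf_mem_sets ((v0 ∈ₛ 0 ⟹ v0 ∈ₛ 1) 1) ⟨trivial, trivial⟩ 0 ⟨_, h.mem⟩ ⟨_, h'.mem⟩
    fun _ => Iff.rfl⟩

instance ArithPred.iff {P Q : M.num → Prop} [h : ArithPred P] [h' : ArithPred Q] :
    ArithPred fun x => P x ↔ Q x :=
  ⟨setOf_mem_sets ((v0 ∈ₛ 0 ⟺ v0 ∈ₛ 1) 1) ⟨⟨trivial, trivial⟩, ⟨trivial, trivial⟩⟩ 0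
    ⟨_, h.mem⟩ ⟨_, h'.mem⟩ fun _ => ⟨fun h => ⟨h.1, h.2⟩, fun h => ⟨h.1, h.2⟩⟩⟩

instance ArithPred.exists {P : M.num → M.num → Prop} [h : ArithPred fun z => P (fst z) (snd z)] :
    ArithPred fun x => ∃ y, P x y :=
  ⟨setOf_mem_sets ((ex fun y => pair v0 y ∈ₛ 0) 1) trivial 0 ⟨_, h.mem⟩ ⟨_, h.mem⟩ fun a =>
    exists_congr fun y => by
      change P (fst (pr a y)) (snd (pr a y)) ↔ P a y
      rw [fst_pr, snd_pr]⟩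

instance ArithPred.forall {P : M.num → M.num → Prop} [h : ArithPred fun z => P (fst z) (snd z)] :
    ArithPred fun x => ∀ y, P x y :=
  ⟨setOf_mem_sets ((all fun y => pair v0 y ∈ₛ 0) 1) trivial 0 ⟨_, h.mem⟩ ⟨_, h.mem⟩ fun a =>
    forall_congr' fun y => by
      change P (fst (pr a y)) (snd (pr a y)) ↔ P a y
      rw [fst_pr, snd_pr]⟩

instance (priority := 50) ArithPred.const (p : Prop) : ArithPred fun _ : M.num => p := by
  by_cases h : p
  · exact ⟨setOf_mem_sets ((v0 ≐ v0) 1) trivial 0 (Classical.arbitrary _) (Classical.arbitrary _)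
      fun _ => iff_of_true rfl h⟩
  · exact ⟨setOf_mem_sets ((∼(v0 ≐ v0)) 1) trivial 0 (Classical.arbitrary _)
      (Classical.arbitrary _) fun _ => iff_of_false (fun h => h rfl) h⟩

theorem ArithPred.comp {P : M.num → Prop} {t : M.num → M.num} (h : ArithPred P) (h' : ArithFun t) :
    ArithPred fun x => P (t x) :=
  ⟨setOf_mem_sets ((ex fun y => pair v0 y ∈ₛ 0 ⩓ y ∈ₛ 1) 1) ⟨trivial, trivial⟩ 0
    ⟨_, h'.mem⟩ ⟨_, h.mem⟩ fun a => by
      change (∃ y, pr a y ∈ graph t ∧ P y) ↔ _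
      simp only [pr_mem_graph, exists_eq_left]⟩

theorem ArithFun.comp {t v : M.num → M.num} (h : ArithFun t) (h' : ArithFun v) :
    ArithFun fun x => t (v x) :=
  ⟨setOf_mem_sets ((ex fun x => ex fun y => ex fun w =>
      v0 ≐ pair x w ⩓ pair x y ∈ₛ 0 ⩓ pair y w ∈ₛ 1) 1) ⟨trivial, trivial, trivial⟩ 0
    ⟨_, h'.mem⟩ ⟨_, h.mem⟩ fun a => by
      change (∃ x y w, a = pr x w ∧ pr x y ∈ graph v ∧ pr y w ∈ graph t) ↔ _
      simp only [pr_mem_graph]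
      exact ⟨fun ⟨x, y, w, h1, h2, h3⟩ => ⟨x, by rw [h1, h3, h2]⟩,
        fun ⟨x, h⟩ => ⟨x, _, _, h, rfl, rfl⟩⟩⟩

instance ArithFun.id : ArithFun fun x : M.num => x :=
  ⟨setOf_mem_sets ((ex fun x => v0 ≐ pair x x) 1) trivial 0 (Classical.arbitrary _)
    (Classical.arbitrary _) fun _ => Iff.rfl⟩

instance (priority := 50) ArithFun.const (c : M.num) : ArithFun fun _ : M.num => c :=
  ⟨setOf_mem_sets ((ex fun x => v0 ≐ pair x v1) 2) trivial c (Classical.arbitrary _)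
    (Classical.arbitrary _) fun _ => Iff.rfl⟩

instance ArithFun.add {t v : M.num → M.num} [h : ArithFun t] [h' : ArithFun v] :
    ArithFun fun x => t x + v x :=
  ⟨setOf_mem_sets ((ex fun x => ex fun y => ex fun w =>
      v0 ≐ pair x (y ⊕ₜ w) ⩓ pair x y ∈ₛ 0 ⩓ pair x w ∈ₛ 1) 1) ⟨trivial, trivial, trivial⟩ 0
    ⟨_, h.mem⟩ ⟨_, h'.mem⟩ fun a => by
      change (∃ x y w, a = pr x (y + w) ∧ pr x y ∈ graph t ∧ pr x w ∈ graph v) ↔ _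
      simp only [pr_mem_graph]
      exact ⟨fun ⟨x, y, w, h1, h2, h3⟩ => ⟨x, by rw [h1, h3, h2]⟩,
        fun ⟨x, h⟩ => ⟨x, _, _, h, rfl, rfl⟩⟩⟩

instance ArithFun.mul {t v : M.num → M.num} [h : ArithFun t] [h' : ArithFun v] :
    ArithFun fun x => t x * v x :=
  ⟨setOf_mem_sets ((ex fun x => ex fun y => ex fun w =>
      v0 ≐ pair x (y ⊙ₜ w) ⩓ pair x y ∈ₛ 0 ⩓ pair x w ∈ₛ 1) 1) ⟨trivial, trivial, trivial⟩ 0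
    ⟨_, h.mem⟩ ⟨_, h'.mem⟩ fun a => by
      change (∃ x y w, a = pr x (y * w) ∧ pr x y ∈ graph t ∧ pr x w ∈ graph v) ↔ _
      simp only [pr_mem_graph]
      exact ⟨fun ⟨x, y, w, h1, h2, h3⟩ => ⟨x, by rw [h1, h3, h2]⟩,
        fun ⟨x, h⟩ => ⟨x, _, _, h, rfl, rfl⟩⟩⟩

instance arithFun_pr {t v : M.num → M.num} [ArithFun t] [ArithFun v] :
    ArithFun fun x => pr (t x) (v x) := by
  unfold pr; infer_instance

instance arithFun_fst : ArithFun (fst : M.num → M.num) :=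
  ⟨setOf_mem_sets ((ex fun x => (ex fun y => ex fun w => x ≐ pair y w ⩓ v0 ≐ pair x y) ⩔
      (all fun y => all fun w => ∼(x ≐ pair y w)) ⩓ v0 ≐ pair x .zero) 1)
    ⟨⟨trivial, trivial⟩, trivial, trivial⟩ 0
    (Classical.arbitrary _) (Classical.arbitrary _) fun a => by
      refine exists_congr fun x => ?_
      change (∃ y w, x = pr y w ∧ a = pr x y) ∨ ((∀ y w, ¬ x = pr y w) ∧ a = pr x 0) ↔ _
      by_cases h : ∃ y w, x = pr y w
      · obtain ⟨y, w, rfl⟩ := h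
        constructor
        · rintro (⟨y', w', h, h'⟩ | ⟨h, _⟩)
          · rw [h', fst_pr, (pr_inj.1 h).1]
          · exact (h y w rfl).elim
        · intro h
          exact Or.inl ⟨y, w, rfl, by rw [h, fst_pr]⟩
      · have hx : fst x = 0 := by unfold fst; rw [dif_neg h]
        rw [hx]
        push Not at h
        constructor
        · rintro (⟨y', w', h1, h'⟩ | ⟨_, h⟩)
          · exact (h y' w' h1).elim
          · exact h
        · exact fun h' => Or.inr ⟨h, h'⟩⟩

instance arithFun_snd : ArithFun (snd : M.num → M.num) :=
  ⟨setOf_mem_sets ((ex fun x => (ex fun y => ex fun w => x ≐ pair y w ⩓ v0 ≐ pair x w) ⩔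
      (all fun y => all fun w => ∼(x ≐ pair y w)) ⩓ v0 ≐ pair x .zero) 1)
    ⟨⟨trivial, trivial⟩, trivial, trivial⟩ 0
    (Classical.arbitrary _) (Classical.arbitrary _) fun a => by
      refine exists_congr fun x => ?_
      change (∃ y w, x = pr y w ∧ a = pr x w) ∨ ((∀ y w, ¬ x = pr y w) ∧ a = pr x 0) ↔ _
      by_cases h : ∃ y w, x = pr y w
      · obtain ⟨y, w, rfl⟩ := h
        constructor
        · rintro (⟨y', w', h, h'⟩ | ⟨h, _⟩)
          · rw [h', snd_pr, (pr_inj.1 h).2]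
          · exact (h y w rfl).elim
        · intro h
          exact Or.inl ⟨y, w, rfl, by rw [h, snd_pr]⟩
      · have hx : snd x = 0 := by unfold snd; rw [dif_neg h]
        rw [hx]
        push Not at h
        constructor
        · rintro (⟨y', w', h1, h'⟩ | ⟨_, h⟩)
          · exact (h y' w' h1).elim
          · exact h
        · exact fun h' => Or.inr ⟨h, h'⟩⟩

instance arithFun_fst_comp {t : M.num → M.num} [h : ArithFun t] : ArithFun fun x => fst (t x) :=
  arithFun_fst.comp h

instance arithFun_snd_comp {t : M.num → M.num} [h : ArithFun t] : ArithFun fun x => snd (t x) :=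
  arithFun_snd.comp h

instance ArithPred.mem_set {t : M.num → M.num} [h : ArithFun t] (A : M.sets) :
    ArithPred fun x => t x ∈ (A : Set M.num) :=
  ArithPred.comp (P := fun x => x ∈ (A : Set M.num)) ⟨A.2⟩ h

instance ArithPred.eq {t v : M.num → M.num} [h : ArithFun t] [h' : ArithFun v] :
    ArithPred fun x => t x = v x :=
  ⟨setOf_mem_sets ((ex fun y => pair v0 y ∈ₛ 0 ⩓ pair v0 y ∈ₛ 1) 1) ⟨trivial, trivial⟩ 0
    ⟨_, h.mem⟩ ⟨_, h'.mem⟩ fun a => by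
      change (∃ y, pr a y ∈ graph t ∧ pr a y ∈ graph v) ↔ _
      simp only [pr_mem_graph, exists_eq_left]⟩

instance ArithPred.ne {t v : M.num → M.num} [h : ArithFun t] [h' : ArithFun v] :
    ArithPred fun x => t x ≠ v x := by
  unfold Ne; infer_instance

instance ArithPred.lt {t v : M.num → M.num} [h : ArithFun t] [h' : ArithFun v] :
    ArithPred fun x => t x < v x :=
  ⟨setOf_mem_sets ((ex fun y => ex fun z => pair v0 y ∈ₛ 0 ⩓ pair v0 z ∈ₛ 1 ⩓ y ⋖ₜ z) 1)
    ⟨trivial, trivial, trivial⟩ 0 ⟨_, h.mem⟩ ⟨_, h'.mem⟩ fun a => by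
      change (∃ y z, pr a y ∈ graph t ∧ pr a z ∈ graph v ∧ y < z) ↔ _
      simp only [pr_mem_graph, exists_eq_left, exists_and_left]⟩

instance ArithPred.le {t v : M.num → M.num} [h : ArithFun t] [h' : ArithFun v] :
    ArithPred fun x => t x ≤ v x := by
  simp only [le_iff_lt_or_eq]; infer_instance

theorem ArithPred.comp₂ {P : M.num → M.num → Prop} (h : ArithPred fun z => P (fst z) (snd z))
    (t v : M.num → M.num) [ArithFun t] [ArithFun v] : ArithPred fun x => P (t x) (v x) := by
  simpa using h.comp (t := fun x => pr (t x) (v x)) inferInstance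

theorem ArithPred.comp₃ {P : M.num → M.num → M.num → Prop}
    (h : ArithPred fun z => P (fst (fst z)) (snd (fst z)) (snd z))
    (t v w : M.num → M.num) [ArithFun t] [ArithFun v] [ArithFun w] :
    ArithPred fun x => P (t x) (v x) (w x) := by
  simpa using h.comp (t := fun x => pr
    (pr (t x) (v x)) (w x)) inferInstance

instance ArithPred.dvd {t v : M.num → M.num} [h : ArithFun t] [h' : ArithFun v] :
    ArithPred fun x => t x ∣ v x :=
  ArithPred.comp₂ (P := fun a b => a ∣ b) (by simp only [dvd_def]; infer_instance) t v

/-! The following instances concern eta-reduced predicates and functions. -/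

instance (A : M.sets) : ArithPred (Membership.mem (A : Set M.num)) := ArithPred.mem_set A

instance (a : M.num) : ArithFun (pr a) := arithFun_pr (t := fun _ => a)

instance (a : M.num) : ArithPred (LT.lt a) := ArithPred.lt (t := fun _ => a)

instance (a : M.num) : ArithPred (LE.le a) := ArithPred.le (t := fun _ => a)

/-- The set of numbers with a given arithmetical property. -/
def setOf (P : M.num → Prop) [h : ArithPred P] : M.sets := ⟨{x | P x}, h.mem⟩

omit hM in
@[simp] theorem mem_setOf {P : M.num → Prop} [h : ArithPred P] {x : M.num} :
    x ∈ (setOf P : Set M.num) ↔ P x := Iff.rfl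

/-- The code of an arithmetical relation. -/
def relOf (P : M.num → M.num → Prop) [ArithPred fun z => P (fst z) (snd z)] : M.sets :=
  setOf fun z => (∃ a b, z = pr a b) ∧ P (fst z) (snd z)

@[simp] theorem mem_relOf {P : M.num → M.num → Prop} [ArithPred fun z => P (fst z) (snd z)]
    {a b : M.num} : pr a b ∈ (relOf P : Set M.num) ↔ P a b := by
  unfold relOf
  rw [mem_setOf, fst_pr, snd_pr]
  exact and_iff_right ⟨a, b, rfl⟩

theorem mem_relOf' {P : M.num → M.num → Prop} [ArithPred fun z => P (fst z) (snd z)]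
    {z : M.num} : z ∈ (relOf P : Set M.num) ↔ ∃ a b, z = pr a b ∧ P a b := by
  unfold relOf
  rw [mem_setOf]
  constructor
  · rintro ⟨⟨a, b, rfl⟩, h⟩
    exact ⟨a, b, rfl, by simpa using h⟩
  · rintro ⟨a, b, rfl, h⟩
    exact ⟨⟨a, b, rfl⟩, by simpa using h⟩

theorem arith_induction {P : M.num → Prop} [h : ArithPred P] (h0 : P 0)
    (h1 : ∀ a, P a → P (a + 1)) (a : M.num) : P a :=
  induction_of_mem_sets h.mem h0 h1 a

theorem arith_strong_induction {P : M.num → Prop} [h : ArithPred P]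
    (h1 : ∀ a, (∀ b, b < a → P b) → P a) (a : M.num) : P a := by
  have : ∀ a, ∀ b, b < a → P b := by
    have hP : ArithPred fun z : M.num => P (snd z) := h.comp inferInstance
    refine arith_induction (fun b hb => (num_not_lt_zero b hb).elim) fun a ih b hb => ?_
    rcases num_lt_succ.1 hb with hb | rfl
    · exact ih b hb
    · exact h1 b ih
  exact h1 a (this a)

/-- The least number principle. -/
theorem arith_least {P : M.num → Prop} [h : ArithPred P] {a : M.num} (ha : P a) :
    ∃ b, P b ∧ ∀ c, c < b → ¬ P c := by
  by_contra hcon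
  push Not at hcon
  refine arith_strong_induction (P := fun x => ¬ P x) (fun x ih hx => ?_) a ha
  obtain ⟨c, hc, hc'⟩ := hcon x hx
  exact ih c hc hc'

end Definability

/-! ### Codes of finite sets -/

section FiniteSets

variable {M : Str.{u}} [hM : M.IsATR]

theorem dvd_of_dvd_add_left {a b d : M.num} (h : d ∣ a) (h' : d ∣ a + b) : d ∣ b := by
  obtain ⟨x, rfl⟩ := h
  obtain ⟨y, hy⟩ := h'
  rcases le_total x y with h | h
  · obtain ⟨w, rfl⟩ := num_le_iff.1 h
    exact ⟨w, add_left_cancel (a := d * x) (by rw [hy]; ring)⟩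
  · obtain ⟨w, rfl⟩ := num_le_iff.1 h
    have : d * w + b = 0 := add_left_cancel (a := d * y) (by rw [add_zero, ← add_assoc, ← mul_add]; exact hy)
    have hb : b = 0 := (add_eq_zero.1 this).2
    exact hb ▸ dvd_zero d

theorem dvd_of_dvd_mul {m i n : M.num} (h : m * (i + 1) + 1 ∣ n * m) : m * (i + 1) + 1 ∣ n := by
  refine dvd_of_dvd_add_left (a := n * m * (i + 1)) (h.mul_right _) ⟨n, ?_⟩
  ring

/-- The moduli `m (i + 1) + 1` and `m (j + 1) + 1` are coprime when `i - j` divides `m`. This avoids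
Bézout's identity: modulo the first number, the second one is `m` times a divisor of `m`, and `m`
can be cancelled. -/
theorem dvd_of_dvd_mul_modulus {m i j n : M.num} (hij : i ≠ j)
    (hd : ∀ e, e < i ∨ e < j → e + 1 ∣ m)
    (h : m * (i + 1) + 1 ∣ n * (m * (j + 1) + 1)) : m * (i + 1) + 1 ∣ n := by
  obtain ⟨e, he, h1⟩ : ∃ e, e + 1 ∣ m ∧ m * (i + 1) + 1 ∣ n * m * (e + 1) := by
    rcases lt_or_gt_of_ne hij with hlt | hlt
    · obtain ⟨e, rfl⟩ := num_lt_iff.1 hlt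
      refine ⟨e, hd e (Or.inr (lt_succ_iff.2 le_add_self)), ?_⟩
      refine dvd_of_dvd_add_left (a := n * (m * (i + 1) + 1)) (dvd_mul_left _ _) ?_
      convert h using 1
      ring
    · obtain ⟨e, rfl⟩ := num_lt_iff.1 hlt
      refine ⟨e, hd e (Or.inl (lt_succ_iff.2 le_add_self)), ?_⟩
      refine dvd_of_dvd_add_left h ⟨n, ?_⟩
      ring
  obtain ⟨f, hf⟩ := he
  have h2 : m * (i + 1) + 1 ∣ n * m * m := by
    refine (h1.mul_right f).trans (dvd_of_eq ?_)
    rw [mul_assoc (n * m), ← hf]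
  exact dvd_of_dvd_mul (dvd_of_dvd_mul h2)

theorem exists_common_multiple (b : M.num) : ∃ m : M.num, m ≠ 0 ∧ ∀ i, i < b → i + 1 ∣ m := by
  refine arith_induction (P := fun b => ∃ m : M.num, m ≠ 0 ∧ ∀ i, i < b → i + 1 ∣ m)
    ⟨1, ?_, fun i hi => (num_not_lt_zero i hi).elim⟩ ?_ b
  · have := num_succ_ne_zero (0 : M.num)
    rwa [zero_add] at this
  · rintro b ⟨m, hm, h⟩
    refine ⟨m * (b + 1), fun h0 => hm ?_, fun i hi => ?_⟩
    · rw [mul_add, mul_one] at h0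
      exact (add_eq_zero.1 h0).2
    · rcases num_lt_succ.1 hi with hi | rfl
      · exact (h i hi).mul_right _
      · exact dvd_mul_left _ _

theorem exists_product (A : M.sets) (b : M.num) : ∃ m n : M.num, ∀ i, i < b →
    (m * (i + 1) + 1 ∣ n ↔ i ∈ (A : Set M.num)) := by
  obtain ⟨m, hm, hdvd⟩ := exists_common_multiple b
  have key : ∀ c : M.num, ∃ n : M.num, ∀ i, i < b →
      (m * (i + 1) + 1 ∣ n ↔ i ∈ (A : Set M.num) ∧ i < c) := by
    refine arith_induction ⟨1, fun i _ => iff_of_false ?_ fun h => num_not_lt_zero _ h.2⟩ ?_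
    · rintro ⟨x, hx⟩
      rcases num_zero_or_succ x with rfl | ⟨y, rfl⟩
      · rw [mul_zero] at hx
        exact num_succ_ne_zero 0 ((zero_add 1).trans hx)
      · have h1 : m * (i + 1) + y * (m * (i + 1) + 1) = 0 :=
          num_add_right_cancel (c := 1) (by rw [zero_add]; conv_rhs => rw [hx]
                                            ring)
        have h2 := (add_eq_zero.1 h1).1
        rw [mul_add, mul_one] at h2
        exact hm (add_eq_zero.1 h2).2
    · rintro c ⟨n, hn⟩
      by_cases hc : c ∈ (A : Set M.num) ∧ c < b
      · refine ⟨n * (m * (c + 1) + 1), fun i hi => ?_⟩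
        by_cases hic : i = c
        · subst hic
          exact iff_of_true (dvd_mul_left _ _) ⟨hc.1, num_lt_succ.2 (Or.inr rfl)⟩
        · have : m * (i + 1) + 1 ∣ n * (m * (c + 1) + 1) ↔ m * (i + 1) + 1 ∣ n :=
            ⟨dvd_of_dvd_mul_modulus hic fun e he => hdvd e (he.elim (fun h => h.trans hi)
              fun h => h.trans hc.2), fun h => h.mul_right _⟩
          rw [this, hn i hi, num_lt_succ]
          simp [hic]
      · refine ⟨n, fun i hi => ?_⟩
        rw [hn i hi, num_lt_succ]
        refine and_congr_right fun hiA => ⟨Or.inl, ?_⟩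
        rintro (h | rfl)
        · exact h
        · exact (hc ⟨hiA, hi⟩).elim
  obtain ⟨n, hn⟩ := key b
  exact ⟨m, n, fun i hi => (hn i hi).trans (and_iff_left hi)⟩

/-- `i` is an element of the finite set coded by `s`. -/
def FinMem (i s : M.num) : Prop :=
  ∃ k m n, s = pr k (pr m n) ∧ i < k ∧ ∃ c, n = (m * (i + 1) + 1) * c

/-- `s` is the canonical code of a finite set. -/
def FinCode (s : M.num) : Prop :=
  ∀ t, t < s → ¬ ∀ i, FinMem i t ↔ FinMem i s

instance {t v : M.num → M.num} [ArithFun t] [ArithFun v] :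
    ArithPred fun x => FinMem (t x) (v x) :=
  ArithPred.comp₂ (by unfold FinMem; infer_instance) t v

instance arithPred_finCode : ArithPred (FinCode : M.num → Prop) := by
  unfold FinCode; infer_instance

instance {t : M.num → M.num} [h : ArithFun t] : ArithPred fun x => FinCode (t x) :=
  arithPred_finCode.comp h

theorem FinMem.lt {i s : M.num} (h : FinMem i s) : i < s := by
  obtain ⟨k, m, n, rfl, h, -⟩ := h
  exact h.trans_le le_add_self

theorem FinCode.ext {s t : M.num} (hs : FinCode s) (ht : FinCode t)
    (h : ∀ i, FinMem i s ↔ FinMem i t) : s = t := by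
  rcases lt_trichotomy s t with hlt | heq | hlt
  · exact (ht s hlt h).elim
  · exact heq
  · exact (hs t hlt fun i => (h i).symm).elim

/-- Every bounded set of the model has a canonical code. -/
theorem exists_code (P : M.num → Prop) [ArithPred P] (b : M.num) :
    ∃ s, FinCode s ∧ ∀ i, FinMem i s ↔ P i ∧ i < b := by
  obtain ⟨m, n, hmn⟩ := exists_product (setOf P) b
  have h0 : ∀ i, FinMem i (pr b (pr m n)) ↔ P i ∧ i < b := by
    intro i
    constructor
    · rintro ⟨k, m', n', h, hi, hd⟩
      obtain ⟨rfl, h'⟩ := pr_inj.1 h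
      obtain ⟨rfl, rfl⟩ := pr_inj.1 h'
      exact ⟨(hmn i hi).1 hd, hi⟩
    · rintro ⟨hP, hi⟩
      exact ⟨b, m, n, rfl, hi, (hmn i hi).2 hP⟩
  obtain ⟨s, hs, hmin⟩ := arith_least (P := fun s => ∀ i, FinMem i s ↔ P i ∧ i < b)
    (h := ArithPred.forall (h := by
      have : ArithPred fun z : M.num => P (snd z) := ArithPred.comp ‹_› inferInstance
      infer_instance)) h0
  exact ⟨s, fun t ht h => hmin t ht fun i => (h i).trans (hs i), hs⟩

end FiniteSets

/-! ### Well orders and lexicographic orders -/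

section Orders

variable {M : Str.{u}} [hM : M.IsATR]

/-- `X` is unbounded. -/
def Unbounded (X : Set M.num) : Prop := ∀ a, ∃ b, a < b ∧ b ∈ X

/-- The set `le` codes a partial order on its field. -/
def IsPartialOrd (le : M.sets) : Prop :=
  (∀ a b, pr a b ∈ le.1 → pr a a ∈ le.1 ∧ pr b b ∈ le.1) ∧
  (∀ a b, pr a b ∈ le.1 ∧ pr b a ∈ le.1 → a = b) ∧
  (∀ a b c, pr a b ∈ le.1 ∧ pr b c ∈ le.1 → pr a c ∈ le.1)

/-- The order coded by `le` is well-founded in the sense of the model `M`. -/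
def IsWellFnd (le : M.sets) : Prop :=
  ∀ A : M.sets, (∃ a, a ∈ A.1 ∧ pr a a ∈ le.1) →
    ∃ m, m ∈ A.1 ∧ pr m m ∈ le.1 ∧ ∀ a, a ∈ A.1 ∧ pr a m ∈ le.1 → a = m

/-- The set `le` codes a well order on its field, in the sense of the model `M`. -/
def IsWellOrd (le : M.sets) : Prop :=
  IsPartialOrd le ∧ IsWellFnd le ∧
    ∀ a b, pr a a ∈ le.1 ∧ pr b b ∈ le.1 → pr a b ∈ le.1 ∨ pr b a ∈ le.1

/-- Transfinite induction for arithmetical predicates. -/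
theorem IsWellFnd.induction {le : M.sets} (h : IsWellFnd le) {P : M.num → Prop} [ArithPred P]
    (ih : ∀ x, pr x x ∈ le.1 → (∀ y, pr y y ∈ le.1 → pr y x ∈ le.1 → y ≠ x → P y) → P x)
    (x : M.num) (hx : pr x x ∈ le.1) : P x := by
  by_contra hcon
  obtain ⟨m, hm, hmm, hmin⟩ := h (setOf fun x => ¬ P x) ⟨x, hcon, hx⟩
  refine hm (ih m hmm fun y _ hym hne => ?_)
  by_contra hy
  exact hne (hmin y ⟨hy, hym⟩)

/-- For a set `C` of pairs, seen as a family of the sets `C_a = {x | (a, x) ∈ C}`, the relation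
`LexLt C a b` says that the least element of the symmetric difference of `C_a` and `C_b` lies
in `C_a`. When the `C_a` are finite sets, viewed as increasing sequences, this is the
Kleene-Brouwer order. -/
def LexLt (C : M.sets) (a b : M.num) : Prop :=
  ∃ x, pr a x ∈ C.1 ∧ ¬ pr b x ∈ C.1 ∧ ∀ y, y < x → (pr a y ∈ C.1 ↔ pr b y ∈ C.1)

instance {C : M.sets} {t v : M.num → M.num} [ArithFun t] [ArithFun v] :
    ArithPred fun x => LexLt C (t x) (v x) :=
  ArithPred.comp₂ (by unfold LexLt; infer_instance) t v

omit hM in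
theorem LexLt.irrefl (C : M.sets) (a : M.num) : ¬ LexLt C a a := fun ⟨_, h, h', _⟩ => h' h

theorem LexLt.trans {C : M.sets} {a b c : M.num} (h : LexLt C a b) (h' : LexLt C b c) :
    LexLt C a c := by
  obtain ⟨x, hxa, hxb, hx⟩ := h
  obtain ⟨y, hyb, hyc, hy⟩ := h'
  rcases lt_trichotomy x y with hlt | rfl | hlt
  · exact ⟨x, hxa, fun h => hxb ((hy x hlt).2 h), fun z hz =>
      (hx z hz).trans (hy z (hz.trans hlt))⟩
  · exact (hxb hyb).elim
  · exact ⟨y, (hx y hlt).2 hyb, hyc, fun z hz => (hx z (hz.trans hlt)).trans (hy z hz)⟩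

theorem LexLt.asymm {C : M.sets} {a b : M.num} (h : LexLt C a b) : ¬ LexLt C b a :=
  fun h' => LexLt.irrefl C a (h.trans h')

theorem LexLt.total (C : M.sets) (a b : M.num) :
    LexLt C a b ∨ LexLt C b a ∨ ∀ x, pr a x ∈ C.1 ↔ pr b x ∈ C.1 := by
  by_cases h : ∀ x, pr a x ∈ C.1 ↔ pr b x ∈ C.1
  · exact Or.inr (Or.inr h)
  · push Not at h
    obtain ⟨x, hx⟩ := h
    obtain ⟨x, hx, hmin⟩ := arith_least (P := fun x => ¬ (pr a x ∈ C.1 ↔ pr b x ∈ C.1))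
      (a := x) (by tauto)
    have hmin' : ∀ y, y < x → (pr a y ∈ C.1 ↔ pr b y ∈ C.1) := fun y hy => not_not.1 (hmin y hy)
    by_cases hxa : pr a x ∈ C.1
    · exact Or.inl ⟨x, hxa, by tauto, hmin'⟩
    · exact Or.inr (Or.inl ⟨x, by tauto, hxa, fun y hy => (hmin' y hy).symm⟩)

/-- A family without a lexicographically minimal member has a leftmost path: an infinite set all of
whose bounded initial parts agree with members of the family. -/
theorem exists_path {C A : M.sets} {a₀ : M.num} (ha₀ : a₀ ∈ A.1)
    (hA : ∀ a, a ∈ A.1 → ∃ b, b ∈ A.1 ∧ LexLt C b a) :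
    ∃ X : M.sets, Unbounded X.1 ∧ ∀ x, ∃ a, a ∈ A.1 ∧ ∀ y, y ≤ x → (pr a y ∈ C.1 ↔ y ∈ X.1) := by
  -- `a` is stable at `x` if no smaller member of the family differs from `a` below `x`.
  let Stable : M.num → M.num → Prop := fun a x => a ∈ A.1 ∧
    ∀ b, b ∈ A.1 → LexLt C b a → ∀ y, y < x → (pr b y ∈ C.1 ↔ pr a y ∈ C.1)
  have inst (t v : M.num → M.num) [ArithFun t] [ArithFun v] :
      ArithPred fun x => Stable (t x) (v x) :=
    ArithPred.comp₂ (P := Stable) (by unfold Stable; infer_instance) t v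
  have hex : ∀ a, a ∈ A.1 → ∀ x, ∃ b, Stable b x ∧ (b = a ∨ LexLt C b a) := by
    intro a ha
    refine arith_induction ⟨a, ⟨ha, fun b _ _ y hy => (num_not_lt_zero y hy).elim⟩, Or.inl rfl⟩ ?_
    rintro x ⟨b, ⟨hb, hst⟩, hba⟩
    by_cases h : ∃ c, c ∈ A.1 ∧ LexLt C c b ∧ pr c x ∈ C.1
    · obtain ⟨c, hc, hcb, hcx⟩ := h
      refine ⟨c, ⟨hc, fun d hd hdc y hy => ?_⟩, Or.inr ?_⟩
      · have hag : ∀ z, z < x → (pr d z ∈ C.1 ↔ pr c z ∈ C.1) := fun z hz =>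
          (hst d hd (hdc.trans hcb) z hz).trans (hst c hc hcb z hz).symm
        rcases num_lt_succ.1 hy with hy | rfl
        · exact hag y hy
        · refine iff_of_true ?_ hcx
          by_contra hdy
          exact hdc.asymm ⟨y, hcx, hdy, fun z hz => (hag z hz).symm⟩
      · rcases hba with rfl | hba
        · exact hcb
        · exact hcb.trans hba
    · refine ⟨b, ⟨hb, fun d hd hdb y hy => ?_⟩, hba⟩
      rcases num_lt_succ.1 hy with hy | rfl
      · exact hst d hd hdb y hy
      · have hdy : pr d y ∉ C.1 := fun hdy => h ⟨d, hd, hdb, hdy⟩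
        refine iff_of_false hdy fun hby => ?_
        exact hdb.asymm ⟨y, hby, hdy, fun z hz => (hst d hd hdb z hz).symm⟩
  have inst' : ArithPred fun x => ∃ a, Stable a (x + 1) ∧ pr a x ∈ C.1 :=
    ArithPred.exists (h := ArithPred.and (h := inst _ _))
  let X : M.sets := setOf fun x => ∃ a, Stable a (x + 1) ∧ pr a x ∈ C.1
  have hX : ∀ a x, Stable a x → ∀ y, y < x → (pr a y ∈ C.1 ↔ y ∈ X.1) := by
    intro a x ha y hy
    refine ⟨fun h => ⟨a, ⟨ha.1, fun b hb hba z hz =>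
      ha.2 b hb hba z ((lt_succ_iff.1 hz).trans_lt hy)⟩, h⟩, ?_⟩
    rintro ⟨b, hb, hby⟩
    rcases LexLt.total C a b with h | h | h
    · exact (hb.2 a ha.1 h y (num_lt_succ.2 (Or.inr rfl))).2 hby
    · exact (ha.2 b hb.1 h y hy).1 hby
    · exact (h y).2 hby
  refine ⟨X, fun c => ?_, fun x => ?_⟩
  · obtain ⟨a, ha, -⟩ := hex a₀ ha₀ (c + 1)
    obtain ⟨b, hb, hba⟩ := hA a ha.1
    obtain ⟨y, hyb, hya, hy⟩ := id hba
    have hcy : c < y := by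
      by_contra hlt
      exact hya ((ha.2 b hb hba y (lt_succ_iff.2 (not_lt.1 hlt))).1 hyb)
    obtain ⟨a', ha', h | h⟩ := hex b hb (y + 1)
    · subst h
      exact ⟨y, hcy, (hX a' _ ha' y (num_lt_succ.2 (Or.inr rfl))).1 hyb⟩
    · obtain ⟨z, hza, hzb, hz⟩ := id h
      rcases lt_trichotomy z y with hlt | rfl | hlt
      · refine ⟨z, ?_, (hX a' _ ha' z (hlt.trans (num_lt_succ.2 (Or.inr rfl)))).1 hza⟩
        by_contra hlt'
        exact hzb ((hy z hlt).2 ((ha.2 a' ha'.1 (h.trans hba) z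
          (lt_succ_iff.2 (not_lt.1 hlt'))).1 hza))
      · exact (hzb hyb).elim
      · exact ⟨y, hcy, (hX a' _ ha' y (num_lt_succ.2 (Or.inr rfl))).1 ((hz y hlt).2 hyb)⟩
  · obtain ⟨a, ha, -⟩ := hex a₀ ha₀ (x + 1)
    exact ⟨a, ha.1, fun y hy => hX a _ ha y (lt_succ_iff.2 hy)⟩

/-- The lexicographic order on the indices in `I`, for the family given by `C`. -/
def lexOrd (I C : M.sets) : M.sets :=
  relOf fun a b => a ∈ I.1 ∧ b ∈ I.1 ∧ (a = b ∨ LexLt C a b)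

theorem mem_lexOrd {I C : M.sets} {a b : M.num} :
    pr a b ∈ (lexOrd I C).1 ↔ a ∈ I.1 ∧ b ∈ I.1 ∧ (a = b ∨ LexLt C a b) := mem_relOf

theorem mem_lexOrd_self {I C : M.sets} {a : M.num} : pr a a ∈ (lexOrd I C).1 ↔ a ∈ I.1 := by
  rw [mem_lexOrd]; tauto

/-- A family of distinct sets is lexicographically well ordered when it has no infinite path. -/
theorem isWellOrd_lexOrd {I C : M.sets}
    (hinj : ∀ a b, a ∈ I.1 → b ∈ I.1 → (∀ x, pr a x ∈ C.1 ↔ pr b x ∈ C.1) → a = b)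
    (hpath : ∀ X : M.sets, Unbounded X.1 →
      ¬ ∀ x, ∃ a, a ∈ I.1 ∧ ∀ y, y ≤ x → (pr a y ∈ C.1 ↔ y ∈ X.1)) :
    IsWellOrd (lexOrd I C) := by
  refine ⟨⟨fun a b h => ?_, fun a b h => ?_, fun a b c h => ?_⟩, fun A hA => ?_, fun a b h => ?_⟩
  · rw [mem_lexOrd] at h
    exact ⟨mem_lexOrd_self.2 h.1, mem_lexOrd_self.2 h.2.1⟩
  · simp only [mem_lexOrd] at h
    obtain ⟨⟨-, -, h | h⟩, -, -, h' | h'⟩ := h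
    exacts [h, h, h'.symm, (h.asymm h').elim]
  · simp only [mem_lexOrd] at h ⊢
    obtain ⟨⟨ha, -, rfl | h⟩, -, hc, rfl | h'⟩ := h
    exacts [⟨ha, hc, Or.inl rfl⟩, ⟨ha, hc, Or.inr h'⟩, ⟨ha, hc, Or.inr h⟩,
      ⟨ha, hc, Or.inr (h.trans h')⟩]
  · by_contra hcon
    obtain ⟨a₀, ha₀, hI₀⟩ := hA
    rw [mem_lexOrd_self] at hI₀
    obtain ⟨X, hX, hX'⟩ := exists_path (C := C) (A := setOf fun a => a ∈ A.1 ∧ a ∈ I.1)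
      (a₀ := a₀) ⟨ha₀, hI₀⟩ (by
        rintro a ⟨ha, haI⟩
        by_contra hmin
        refine hcon ⟨a, ha, mem_lexOrd_self.2 haI, fun b hb => ?_⟩
        obtain ⟨hbA, hb⟩ := hb
        rw [mem_lexOrd] at hb
        obtain ⟨hbI, -, rfl | hlt⟩ := hb
        · rfl
        · exact (hmin ⟨b, ⟨hbA, hbI⟩, hlt⟩).elim)
    refine hpath X hX fun x => ?_
    obtain ⟨a, ha, h⟩ := hX' x
    exact ⟨a, ha.2, h⟩
  · simp only [mem_lexOrd_self] at h
    simp only [mem_lexOrd]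
    rcases LexLt.total C a b with hlt | hlt | heq
    · exact Or.inl ⟨h.1, h.2, Or.inr hlt⟩
    · exact Or.inr ⟨h.2, h.1, Or.inr hlt⟩
    · exact Or.inl ⟨h.1, h.2, Or.inl (hinj a b h.1 h.2 heq)⟩

/-- The usual order of the numbers, as a set of the model. -/
def numOrd (M : Str.{u}) [M.IsATR] : M.sets := relOf fun a b : M.num => a ≤ b

theorem mem_numOrd {a b : M.num} : pr a b ∈ (numOrd M).1 ↔ a ≤ b := mem_relOf

theorem isWellOrd_numOrd : IsWellOrd (numOrd M) := by
  refine ⟨⟨fun a b _ => ?_, fun a b h => ?_, fun a b c h => ?_⟩, fun A hA => ?_, fun a b _ => ?_⟩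
  · simp [mem_numOrd]
  · simp only [mem_numOrd] at h
    exact le_antisymm h.1 h.2
  · simp only [mem_numOrd] at h ⊢
    exact h.1.trans h.2
  · obtain ⟨a, ha, -⟩ := hA
    obtain ⟨m, hm, hmin⟩ := arith_least (P := fun a => a ∈ A.1) ha
    refine ⟨m, hm, by simp [mem_numOrd], fun b hb => ?_⟩
    rw [mem_numOrd] at hb
    by_contra hne
    exact hmin b (lt_of_le_of_ne hb.2 hne) hb.1
  · simp only [mem_numOrd]
    exact le_total a b

end Orders

/-! ### Arithmetical transfinite recursion -/

section Recursion

variable {M : Str.{u}} [hM : M.IsATR]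

/-- The part of `Y` below the stage `j`. -/
def belowSet (le Y : M.sets) (j : M.num) : M.sets :=
  relOf fun m i => (pr i j ∈ le.1 ∧ i ≠ j) ∧ pr m i ∈ Y.1

theorem mem_belowSet {le Y : M.sets} {j m i : M.num} :
    pr m i ∈ (belowSet le Y j).1 ↔ (pr i j ∈ le.1 ∧ i ≠ j) ∧ pr m i ∈ Y.1 := mem_relOf

/-- Transfinite recursion for a formula `θ` in the number variable `0` and the set variable `0`,
with set parameters `p`. -/
theorem exists_transfinite_recursion {le : M.sets} (hwo : IsWellOrd le) (θ : Fml)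
    (hθ : θ.Arithmetical) (hj : ¬ θ.FreeN 1) (hle : ¬ θ.FreeS 1) (hY : ¬ θ.FreeS 2)
    (p : SVar → M.sets) : ∃ Y : M.sets, ∀ n j, pr n j ∈ Y.1 ↔ pr j j ∈ le.1 ∧
      θ.Sat M (assign (fun _ => 0) 0 n) (assign p 0 (belowSet le Y j)) := by
  let s : SVar → M.sets := fun k => if k = 1 then le else p k
  obtain ⟨Y, h⟩ := hM.models _
    (Or.inr ⟨θ, 0, 1, 0, 1, 2, hθ, by decide, by decide, by decide, by decide, hj, hY, rfl⟩)
    (fun _ => 0) s hwo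
  refine ⟨Y, fun n j => ?_⟩
  have h1 : pr n j ∈ Y.1 ↔ pr j j ∈ le.1 ∧ ∃ Z : M.sets,
      (∀ z, z ∈ Z.1 ↔ ∃ m i, z = pr m i ∧ (pr i j ∈ le.1 ∧ i ≠ j) ∧ pr m i ∈ Y.1) ∧
      θ.Sat M (assign (assign (fun _ => 0) 0 n) 1 j) (assign (assign s 2 Y) 0 Z) := by
    have h2 := h n j
    constructor
    · intro h3
      obtain ⟨h4, Z, h5, h6⟩ := h2.1 h3
      exact ⟨h4, Z, fun z => ⟨(h5 z).1, (h5 z).2⟩, h6⟩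
    · rintro ⟨h4, Z, h5, h6⟩
      exact h2.2 ⟨h4, Z, fun z => ⟨(h5 z).1, (h5 z).2⟩, h6⟩
  have h2 : ∀ Z, θ.Sat M (assign (assign (fun _ => 0) 0 n) 1 j) (assign (assign s 2 Y) 0 Z) ↔
      θ.Sat M (assign (fun _ => 0) 0 n) (assign p 0 Z) := by
    intro Z
    refine θ.sat_congr M (fun i hi => ?_) fun k hk => ?_
    · have : i ≠ 1 := fun h => hj (h ▸ hi)
      simp [assign, this]
    · have h1 : k ≠ 1 := fun h => hle (h ▸ hk)
      have h2 : k ≠ 2 := fun h => hY (h ▸ hk)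
      simp [assign, h1, h2, s]
  rw [h1]
  refine and_congr_right fun _ => ⟨?_, fun h3 => ⟨belowSet le Y j, fun z => mem_relOf', ?_⟩⟩
  · rintro ⟨Z, hZ, h3⟩
    have : Z = belowSet le Y j := Subtype.ext (Set.ext fun z => (hZ z).trans mem_relOf'.symm)
    exact this ▸ (h2 Z).1 h3
  · exact (h2 _).2 h3

/-- Course-of-values recursion along a well order: the stage `j` of a relation consists of those `p`
with `D p j` that are related by `S` to all elements of the earlier stages. -/
theorem exists_recursion {le : M.sets} (hwo : IsWellOrd le) (D : M.num → M.num → Prop)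
    (S : M.num → M.num → M.num → M.num → Prop) [ArithPred fun z => D (fst z) (snd z)]
    [hS : ArithPred fun z => S (fst (fst (fst z))) (snd (fst (fst z))) (snd (fst z)) (snd z)] :
    ∃ Y : M.sets, ∀ p j, pr p j ∈ Y.1 ↔ pr j j ∈ le.1 ∧ D p j ∧
      ∀ r i, pr i j ∈ le.1 → i ≠ j → pr r i ∈ Y.1 → S p j r i := by
  have inst : ArithPred fun z : M.num => snd (fst (snd z)) = snd (snd z) →
      S (fst (fst z)) (snd (fst z)) (fst (fst (snd z))) (snd (snd z)) :=
    ArithPred.imp (h' := by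
      simpa using hS.comp (t := fun z => pr (pr (pr (fst (fst z)) (snd (fst z)))
        (fst (fst (snd z)))) (snd (snd z))) inferInstance)
  -- The recursion formula must not mention the stage, which thus becomes part of the elements: the
  -- stage `j` of the auxiliary set `Y` consists of pairs `(p, j')`, and only those with `j' = j`
  -- matter.
  let DD : M.sets := relOf D
  let SS : M.sets := relOf fun n m => snd (fst m) = snd m →
    S (fst n) (snd n) (fst (fst m)) (snd m)
  obtain ⟨Y, hY⟩ := exists_transfinite_recursion hwo
    ((.var 0 ∈ₛ 3 ⩓ all fun m => m ∈ₛ 0 ⟹ pair (.var 0) m ∈ₛ 4) 2)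
    (by simp [Fml.Arithmetical, both, all, imp, mem])
    (by simp [Fml.FreeN, Tm.OccursN, both, all, imp, mem, pair])
    (by simp [Fml.FreeS, both, all, imp, mem]) (by simp [Fml.FreeS, both, all, imp, mem])
    (fun k => if k = 3 then DD else SS)
  have hY' : ∀ n j, pr n j ∈ Y.1 ↔ pr j j ∈ le.1 ∧ n ∈ DD.1 ∧
      ∀ m, m ∈ (belowSet le Y j).1 → pr n m ∈ SS.1 := hY
  refine ⟨relOf fun p j => pr (pr p j) j ∈ Y.1, fun p j => ?_⟩
  simp only [mem_relOf, hY' (pr p j) j]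
  refine and_congr_right fun _ => and_congr mem_relOf ⟨fun h r i hij hne hr => ?_, fun h m hm => ?_⟩
  · have := h (pr (pr r i) i) (mem_belowSet.2 ⟨⟨hij, hne⟩, hr⟩)
    simpa using mem_relOf.1 this
  · refine mem_relOf.2 fun h1 => ?_
    obtain ⟨m', i, rfl, ⟨hij, hne⟩, hm'⟩ := mem_relOf'.1 hm
    obtain ⟨r, i', rfl, -⟩ := mem_relOf'.1 ((hY' _ _).1 hm').2.1
    simp only [fst_pr, snd_pr] at h1 ⊢
    subst h1
    exact h r i' hij hne hm'

end Recursion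

/-! ### The order `≤_Q` -/

section PartialRanking

variable {M : Str.{u}} [hM : M.IsATR]

/-- `R` codes a reflexive relation on `Q`. -/
def IsReflOn (R Q : M.sets) : Prop :=
  (∀ z, z ∈ R.1 → ∃ p q, z = pr p q ∧ p ∈ Q.1 ∧ q ∈ Q.1) ∧ ∀ p, p ∈ Q.1 → pr p p ∈ R.1

/-- `le` codes a partial order on `Q` that is well-founded in the sense of `M`. -/
def IsWfPartialOrdOn (le Q : M.sets) : Prop :=
  IsReflOn le Q ∧ IsPartialOrd le ∧ IsWellFnd le

theorem IsReflOn.mem {R Q : M.sets} (h : IsReflOn R Q) {p q : M.num} (hpq : pr p q ∈ R.1) :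
    p ∈ Q.1 ∧ q ∈ Q.1 := by
  obtain ⟨p', q', h1, h2, h3⟩ := h.1 _ hpq
  obtain ⟨rfl, rfl⟩ := pr_inj.1 h1
  exact ⟨h2, h3⟩

/-- Any well-founded partial order extends to a well order. For each `p`, scan the numbers
`0, 1, 2, …` and collect those `x ≥ p` that lie below all numbers collected before. The result `C_p`
is a descending sequence that ends with `p`. The lexicographic order of the sets `C_p` has no
infinite path, which would be a descending sequence, and it extends the given order: if `p < q` then
everything above `q` is also above `p`, so that a first difference between `C_p` and `C_q` lies
in `C_p`. -/
theorem exists_linear_extension {le Q : M.sets} (h : IsWfPartialOrdOn le Q) :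
    ∃ L : M.sets, IsWellOrd L ∧ (∀ p, pr p p ∈ L.1 ↔ p ∈ Q.1) ∧
      ∀ p q, pr p q ∈ le.1 → pr p q ∈ L.1 := by
  obtain ⟨hrefl, ⟨-, hanti, htrans⟩, hwf⟩ := h
  obtain ⟨C, hC⟩ := exists_recursion (isWellOrd_numOrd (M := M)) (fun p x => pr p x ∈ le.1)
    (fun p x r y => r = p → pr x y ∈ le.1 ∧ x ≠ y)
  have hC' : ∀ p x, pr p x ∈ C.1 ↔ pr p x ∈ le.1 ∧
      ∀ y, y < x → pr p y ∈ C.1 → pr x y ∈ le.1 ∧ x ≠ y := by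
    intro p x
    rw [hC p x]
    simp only [mem_numOrd]
    constructor
    · rintro ⟨-, h1, h2⟩
      exact ⟨h1, fun y hy hy' => h2 p y hy.le hy.ne hy' rfl⟩
    · rintro ⟨h1, h2⟩
      refine ⟨le_rfl, h1, fun r y hyx hne hr hrp => ?_⟩
      subst hrp
      exact h2 y (lt_of_le_of_ne hyx hne) hr
  have hself : ∀ p, p ∈ Q.1 → pr p p ∈ C.1 := fun p hp =>
    (hC' p p).2 ⟨hrefl.2 p hp, fun y hy hy' => ⟨((hC' p y).1 hy').1, hy.ne'⟩⟩
  refine ⟨lexOrd Q C, isWellOrd_lexOrd (fun a b ha hb hab => ?_) (fun X hX hpath => ?_),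
    fun p => mem_lexOrd_self, fun p q hpq => ?_⟩
  · have h1 := (hC' b a).1 ((hab a).1 (hself a ha))
    have h2 := (hC' a b).1 ((hab b).2 (hself b hb))
    exact hanti a b ⟨h2.1, h1.1⟩
  · obtain ⟨x, -, hx⟩ := hX 0
    obtain ⟨a, -, ha⟩ := hpath x
    have hax := ((hC' a x).1 ((ha x le_rfl).2 hx)).1
    obtain ⟨m, hm, -, hmin⟩ := hwf X ⟨x, hx, hrefl.2 x (hrefl.mem hax).2⟩
    obtain ⟨b, hb, hbX⟩ := hX m
    obtain ⟨a, -, ha⟩ := hpath b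
    have := ((hC' a b).1 ((ha b le_rfl).2 hbX)).2 m hb ((ha m hb.le).2 hm)
    exact this.2 (hmin b ⟨hbX, this.1⟩)
  · obtain ⟨hp, hq⟩ := hrefl.mem hpq
    refine mem_lexOrd.2 ⟨hp, hq, ?_⟩
    rcases LexLt.total C p q with hlt | ⟨x, hxq, hxp, hx⟩ | heq
    · exact Or.inr hlt
    · obtain ⟨h1, h2⟩ := (hC' q x).1 hxq
      exact (hxp ((hC' p x).2 ⟨htrans p q x ⟨hpq, h1⟩, fun y hy hy' =>
        h2 y hy ((hx y hy).2 hy')⟩)).elim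
    · exact Or.inl (hanti p q ⟨hpq, ((hC' q p).1 ((heq p).1 (hself p hp))).1⟩)

/-- By recursion along a well order `L` that extends the partial ranking `le'`, put `p ≤_Q q` if
`p = q`, or if `p` precedes `q` in `L` and all `r ≤_Q p` satisfy `r R q`. When `p` precedes `q` but
`p ≤_Q q` fails, there is thus a witness `r ≤_Q p` with `¬ r R q`. -/
theorem exists_pouzet_order {Q R le' L : M.sets} (hR : IsReflOn R Q) (h : IsWfPartialOrdOn le' Q)
    (hrank : ∀ p q r, pr p q ∈ R.1 ∧ pr q r ∈ le'.1 → pr p r ∈ R.1) (hL : IsWellOrd L)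
    (hLQ : ∀ p, pr p p ∈ L.1 ↔ p ∈ Q.1) (hL' : ∀ p q, pr p q ∈ le'.1 → pr p q ∈ L.1) :
    ∃ leQ : M.sets, IsWfPartialOrdOn leQ Q ∧ (∀ z, z ∈ le'.1 → z ∈ leQ.1) ∧
      (∀ z, z ∈ leQ.1 → z ∈ R.1) ∧
      ∀ p q, pr p q ∈ L.1 → p ≠ q → ¬ pr p q ∈ leQ.1 →
        ∃ r, pr r p ∈ leQ.1 ∧ ¬ pr r q ∈ R.1 := by
  obtain ⟨Y, hY⟩ := exists_recursion hL (fun p q => pr p q ∈ L.1)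
    (fun p q r i => i = p → pr r q ∈ R.1)
  obtain ⟨⟨hLfield, hLanti, hLtrans⟩, hLwf, -⟩ := hL
  let leQ : M.sets := relOf fun p q => pr p q ∈ Y.1
  have hleQ : ∀ p q, pr p q ∈ leQ.1 ↔
      pr p q ∈ L.1 ∧ (p ≠ q → ∀ r, pr r p ∈ leQ.1 → pr r q ∈ R.1) := by
    intro p q
    simp only [leQ, mem_relOf]
    rw [hY p q]
    constructor
    · rintro ⟨-, h1, h2⟩
      exact ⟨h1, fun hne r hr => h2 r p h1 hne hr rfl⟩
    · rintro ⟨h1, h2⟩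
      refine ⟨(hLfield _ _ h1).2, h1, fun r i hi hne hr hip => ?_⟩
      subst hip
      exact h2 hne r hr
  have hself : ∀ p, p ∈ Q.1 → pr p p ∈ leQ.1 := fun p hp =>
    (hleQ p p).2 ⟨(hLQ p).2 hp, fun hne => (hne rfl).elim⟩
  have hmem : ∀ p q, pr p q ∈ leQ.1 → p ∈ Q.1 ∧ q ∈ Q.1 := fun p q hpq =>
    have := hLfield _ _ ((hleQ p q).1 hpq).1
    ⟨(hLQ p).1 this.1, (hLQ q).1 this.2⟩
  have hsubR : ∀ p q, pr p q ∈ leQ.1 → pr p q ∈ R.1 := by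
    intro p q hpq
    by_cases hne : p = q
    · subst hne
      exact hR.2 p (hmem _ _ hpq).1
    · exact ((hleQ p q).1 hpq).2 hne p (hself p (hmem _ _ hpq).1)
  have htrans : ∀ q, pr q q ∈ L.1 → ∀ r p, pr r p ∈ leQ.1 → pr p q ∈ leQ.1 → pr r q ∈ leQ.1 := by
    refine hLwf.induction fun q _ ih r p hrp hpq => ?_
    by_cases hne : p = q
    · exact hne ▸ hrp
    obtain ⟨h1, h2⟩ := (hleQ p q).1 hpq
    have h3 := ((hleQ r p).1 hrp).1
    refine (hleQ r q).2 ⟨hLtrans _ _ _ ⟨h3, h1⟩, fun _ s hs => h2 hne s ?_⟩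
    exact ih p (hLfield _ _ h1).1 h1 hne s r hs hrp
  refine ⟨leQ, ⟨⟨fun z hz => ?_, hself⟩, ⟨fun p q hpq => ?_, fun p q hpq => ?_, fun r p q hpq => ?_⟩,
    fun A hA => ?_⟩, fun z hz => ?_, fun z hz => ?_, fun p q hpq hne hnot => ?_⟩
  · obtain ⟨p, q, rfl, h⟩ := mem_relOf'.1 hz
    exact ⟨p, q, rfl, hmem p q hz⟩
  · exact ⟨hself p (hmem _ _ hpq).1, hself q (hmem _ _ hpq).2⟩
  · exact hLanti p q ⟨((hleQ _ _).1 hpq.1).1, ((hleQ _ _).1 hpq.2).1⟩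
  · exact htrans q (hLfield _ _ ((hleQ _ _).1 hpq.2).1).2 r p hpq.1 hpq.2
  · obtain ⟨a, haA, ha⟩ := hA
    obtain ⟨m, hm, hmm, hmin⟩ := hLwf A ⟨a, haA, ((hleQ _ _).1 ha).1⟩
    exact ⟨m, hm, hself m ((hLQ m).1 hmm), fun b hb => hmin b ⟨hb.1, ((hleQ _ _).1 hb.2).1⟩⟩
  · obtain ⟨p, q, rfl, -⟩ := h.1.1 z hz
    exact (hleQ p q).2 ⟨hL' p q hz, fun _ r hr => hrank r p q ⟨hsubR r p hr, hz⟩⟩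
  · obtain ⟨p, q, rfl, -⟩ := mem_relOf'.1 hz
    exact hsubR p q hz
  · by_contra hcon
    push Not at hcon
    exact hnot ((hleQ p q).2 ⟨hpq, fun _ => hcon⟩)

end PartialRanking

/-! ### The clopen Ramsey theorem -/

section Ramsey

variable {M : Str.{u}} [hM : M.IsATR]

/-- Greedy choice: there is a set `G` that contains `x` precisely if `P x` holds and all smaller
elements of `G` are `H`-related to `x`. It is also described by an arithmetical formula that
quantifies over the codes of the initial parts of `G`. -/
theorem exists_greedy (P : M.num → Prop) (H : M.num → M.num → Prop) [hP : ArithPred P]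
    [hH : ArithPred fun z => H (fst z) (snd z)] : ∃ G : M.sets,
      (∀ x, x ∈ G.1 ↔ P x ∧ ∀ y, y ∈ G.1 → y < x → H y x) ∧
      ∀ x, (∃ F, FinMem x F ∧ ∀ z, ¬ x < z →
        (FinMem z F ↔ P z ∧ ∀ y, FinMem y F ∧ y < z → H y z)) ↔ x ∈ G.1 := by
  have inst1 : ArithPred fun z : M.num => P (snd z) := hP.comp inferInstance
  have inst2 : ArithPred fun z : M.num => H (snd z) (snd (fst (fst z))) := hH.comp₂ _ _
  obtain ⟨Y, hY⟩ := exists_recursion (isWellOrd_numOrd (M := M)) (fun _ x => P x)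
    (fun p x r y => r = p → H y x)
  let G : M.sets := setOf fun x => pr 0 x ∈ Y.1
  have hG : ∀ x, x ∈ G.1 ↔ P x ∧ ∀ y, y ∈ G.1 → y < x → H y x := by
    intro x
    change pr 0 x ∈ Y.1 ↔ P x ∧ ∀ y, pr 0 y ∈ Y.1 → y < x → H y x
    rw [hY 0 x]
    simp only [mem_numOrd]
    constructor
    · rintro ⟨-, h1, h2⟩
      exact ⟨h1, fun y hy hyx => h2 0 y hyx.le hyx.ne hy rfl⟩
    · rintro ⟨h1, h2⟩
      refine ⟨le_rfl, h1, fun r y hyx hne hr hrp => ?_⟩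
      subst hrp
      exact h2 y hr (lt_of_le_of_ne hyx hne)
  refine ⟨G, hG, fun x => ⟨?_, fun hx => ?_⟩⟩
  · rintro ⟨F, hxF, hF⟩
    have hagree : ∀ z, ¬ x < z → (FinMem z F ↔ z ∈ G.1) := by
      refine arith_strong_induction fun z ih hz => ?_
      rw [hF z hz, hG z]
      refine and_congr_right fun _ => forall_congr' fun y => ⟨fun h hy hyz => ?_, fun h hy => ?_⟩
      · exact h ⟨(ih y hyz fun h' => hz (h'.trans hyz)).2 hy, hyz⟩
      · exact h ((ih y hy.2 fun h' => hz (h'.trans hy.2)).1 hy.1) hy.2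
    exact (hagree x (lt_irrefl x)).1 hxF
  · obtain ⟨F, -, hF⟩ := exists_code (fun z => z ∈ G.1) (x + 1)
    have hF' : ∀ z, ¬ x < z → (FinMem z F ↔ z ∈ G.1) := fun z hz => by
      rw [hF z, lt_succ_iff]
      exact and_iff_left (not_lt.1 hz)
    refine ⟨F, (hF' x (lt_irrefl x)).2 hx, fun z hz => ?_⟩
    rw [hF' z hz, hG z]
    refine and_congr_right fun _ => forall_congr' fun y => ⟨fun h hy => ?_, fun h hy hyz => ?_⟩
    · exact h ((hF' y fun h' => hz (h'.trans hy.2)).1 hy.1) hy.2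
    · exact h ⟨(hF' y fun h' => hz (h'.trans hyz)).2 hy, hyz⟩

/-- The transfinite recursion behind the Ramsey theorem. For each stage `t` of the well order `Lt`,
it yields a set `H_t = {x | (x, t) ∈ H}` and a colour, which is recorded by membership in `c`. The
set `G` of the stage `t` is chosen greedily: all `x ∈ G` above some `y ∈ G` lie in the sets `H_r` of
the earlier stages `r` with `r ≤ y`, and of the earlier stages `r` with `S t y r`. The colour of `t`
is one that occurs infinitely often among the colours of the `u` with `S t x u` for `x ∈ G`, and
`H_t` consists of those `x ∈ G` that yield this colour. -/
theorem exists_ramsey_hierarchy {Lt U K S : M.sets} (hL : IsWellOrd Lt)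
    (hS : ∀ t x u, pr (pr t x) u ∈ S.1 → pr t t ∈ Lt.1 → pr u u ∈ Lt.1 → pr u t ∈ Lt.1 ∧ u ≠ t) :
    ∃ H c : M.sets, (∀ t, t ∈ c.1 → pr t t ∈ Lt.1) ∧ ∀ t, pr t t ∈ Lt.1 → ∃ G : M.sets,
      (∀ x, x ∈ G.1 ↔ (x ∈ U.1 ∧ t ≤ x) ∧ ∀ y, y ∈ G.1 → y < x → ∀ r, pr r t ∈ Lt.1 → r ≠ t →
        (r ≤ y ∨ pr (pr t y) r ∈ S.1) → pr x r ∈ H.1) ∧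
      (t ∈ c.1 ↔ ∀ a, ∃ x, a < x ∧ x ∈ G.1 ∧ ∃ u, pr (pr t x) u ∈ S.1 ∧ (u ∈ K.1 ∨ u ∈ c.1)) ∧
      ∀ x, pr x t ∈ H.1 ↔
        x ∈ G.1 ∧ ((∃ u, pr (pr t x) u ∈ S.1 ∧ (u ∈ K.1 ∨ u ∈ c.1)) ↔ t ∈ c.1) := by
  let FM : M.sets := relOf fun F x => FinMem x F
  let VV : M.sets := relOf fun t z => z ∈ U.1 ∧ t ≤ z
  let E : M.sets := relOf fun w r => pr r (fst w) ∈ Lt.1 ∧ r ≠ fst w ∧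
    (r ≤ snd w ∨ pr w r ∈ S.1)
  -- The set variables `3`, …, `7` stand for `FM`, `VV`, `E`, `S` and `K`. An element `(x + 1, t)` of
  -- the stage `t` records that `x` lies in `H_t`, and the element `(0, t)` records the colour of `t`.
  -- The stage is included because a recursion formula must not mention it.
  let greedy : Tm → Tm → Bld := fun t x => ex fun F => rel 3 F x ⩓ all fun z => ∼(x ⋖ₜ z) ⟹
    (rel 3 F z ⟺ rel 4 t z ⩓ all fun y => rel 3 F y ⩓ y ⋖ₜ z ⟹ all fun r =>
      rel 5 (pair t y) r ⟹ rel 0 (pair (z ⊕ₜ .one) r) r)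
  let succColour : Tm → Tm → Bld := fun t x => ex fun u => rel 6 (pair t x) u ⩓
    (u ∈ₛ 7 ⩔ rel 0 (pair .zero u) u)
  let colour : Tm → Bld := fun t => all fun a => ex fun x => a ⋖ₜ x ⩓ greedy t x ⩓ succColour t x
  let θ : Fml := (ex fun w => ex fun t => .var 0 ≐ pair w t ⩓
    ((w ≐ .zero ⩓ colour t) ⩔ ex fun x => w ≐ x ⊕ₜ .one ⩓ greedy t x ⩓
      (succColour t x ⟺ colour t))) 2
  obtain ⟨Y, hY⟩ := exists_transfinite_recursion hL θ
    (by simp [θ, greedy, succColour, colour, Fml.Arithmetical, both, either, all, ex, imp, mem, no,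
      teq, tlt, rel, iff])
    (by simp [θ, greedy, succColour, colour, Fml.FreeN, Tm.OccursN, both, either, all, ex, imp, mem,
      no, teq, tlt, rel, iff, pair])
    (by simp [θ, greedy, succColour, colour, Fml.FreeS, both, either, all, ex, imp, mem, no, teq,
      tlt, rel, iff])
    (by simp [θ, greedy, succColour, colour, Fml.FreeS, both, either, all, ex, imp, mem, no, teq,
      tlt, rel, iff])
    (fun k => if k = 3 then FM else if k = 4 then VV else if k = 5 then E else if k = 6 then S
      else K)
  let Gr : M.sets → M.num → M.num → Prop := fun Z t x => ∃ F, pr F x ∈ FM.1 ∧ ∀ z, ¬ x < z →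
    (pr F z ∈ FM.1 ↔ pr t z ∈ VV.1 ∧ ∀ y, pr F y ∈ FM.1 ∧ y < z → ∀ r, pr (pr t y) r ∈ E.1 →
      pr (pr (z + 1) r) r ∈ Z.1)
  let Sc : M.sets → M.num → M.num → Prop := fun Z t x => ∃ u, pr (pr t x) u ∈ S.1 ∧
    (u ∈ K.1 ∨ pr (pr 0 u) u ∈ Z.1)
  let Co : M.sets → M.num → Prop := fun Z t => ∀ a, ∃ x, a < x ∧ Gr Z t x ∧ Sc Z t x
  have hY' : ∀ n j, pr n j ∈ Y.1 ↔ pr j j ∈ Lt.1 ∧ ∃ w t, n = pr w t ∧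
      ((w = 0 ∧ Co (belowSet Lt Y j) t) ∨ ∃ x, w = x + 1 ∧ Gr (belowSet Lt Y j) t x ∧
        (Sc (belowSet Lt Y j) t x ↔ Co (belowSet Lt Y j) t)) := by
    simp only [Co, Gr, Sc, iff_iff_implies_and_implies (a := pr _ _ ∈ FM.1),
      iff_iff_implies_and_implies (a := ∃ u, _)]
    exact hY
  have hcol : ∀ t, pr (pr 0 t) t ∈ Y.1 ↔ pr t t ∈ Lt.1 ∧ Co (belowSet Lt Y t) t := by
    intro t
    rw [hY']
    refine and_congr_right fun _ => ⟨?_, fun h => ⟨0, t, rfl, Or.inl ⟨rfl, h⟩⟩⟩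
    rintro ⟨w, t', h1, h2⟩
    obtain ⟨rfl, rfl⟩ := pr_inj.1 h1
    rcases h2 with h2 | ⟨x, h2, -⟩
    · exact h2.2
    · exact (num_succ_ne_zero x h2.symm).elim
  have hset : ∀ t x, pr (pr (x + 1) t) t ∈ Y.1 ↔ pr t t ∈ Lt.1 ∧ Gr (belowSet Lt Y t) t x ∧
      (Sc (belowSet Lt Y t) t x ↔ Co (belowSet Lt Y t) t) := by
    intro t x
    rw [hY']
    refine and_congr_right fun _ => ⟨?_, fun h => ⟨x + 1, t, rfl, Or.inr ⟨x, rfl, h⟩⟩⟩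
    rintro ⟨w, t', h1, h2⟩
    obtain ⟨rfl, rfl⟩ := pr_inj.1 h1
    rcases h2 with h2 | ⟨x', h2, h3⟩
    · exact (num_succ_ne_zero x h2.1).elim
    · obtain rfl := num_succ_inj h2
      exact h3
  refine ⟨relOf fun x r => pr (pr (x + 1) r) r ∈ Y.1, setOf fun r => pr (pr 0 r) r ∈ Y.1,
    fun t ht => ((hcol t).1 ht).1, fun t ht => ?_⟩
  have hSc : ∀ x, Sc (belowSet Lt Y t) t x ↔
      ∃ u, pr (pr t x) u ∈ S.1 ∧ (u ∈ K.1 ∨ pr (pr 0 u) u ∈ Y.1) := by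
    refine fun x => exists_congr fun u => and_congr_right fun hu => or_congr Iff.rfl ?_
    rw [mem_belowSet]
    exact ⟨fun h => h.2, fun h => ⟨hS t x u hu ht ((hcol u).1 h).1, h⟩⟩
  obtain ⟨G, hG, hG'⟩ := exists_greedy (fun x => x ∈ U.1 ∧ t ≤ x)
    (fun y z => ∀ r, pr r t ∈ Lt.1 → r ≠ t → (r ≤ y ∨ pr (pr t y) r ∈ S.1) →
      pr (pr (z + 1) r) r ∈ Y.1)
  have hGr : ∀ x, Gr (belowSet Lt Y t) t x ↔ x ∈ G.1 := by
    intro x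
    rw [← hG']
    simp only [Gr, FM, VV, E, mem_relOf, fst_pr, snd_pr, mem_belowSet]
    refine exists_congr fun F => and_congr_right fun _ => forall_congr' fun z =>
      imp_congr Iff.rfl (iff_congr Iff.rfl (and_congr_right fun _ => forall_congr' fun y =>
        imp_congr Iff.rfl (forall_congr' fun r => ?_)))
    tauto
  refine ⟨G, fun x => ?_, ?_, fun x => ?_⟩
  · rw [hG x]
    simp only [mem_relOf]
  · simp only [mem_setOf]
    rw [hcol, and_iff_right ht]
    simp only [Co, hGr, hSc]
  · simp only [mem_setOf, mem_relOf]
    rw [hset, and_iff_right ht, hGr, hSc, hcol, and_iff_right ht]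

/-- In the situation of `exists_ramsey_hierarchy`, the sets `H_t` are infinite, and they decrease
along the well order up to finite sets. -/
theorem ramsey_hierarchy_unbounded {Lt U K S H c : M.sets} (hL : IsWellOrd Lt)
    (hU : Unbounded U.1)
    (hSfun : ∀ t x u u', pr (pr t x) u ∈ S.1 → pr (pr t x) u' ∈ S.1 → u = u')
    (h : ∀ t, pr t t ∈ Lt.1 → ∃ G : M.sets,
      (∀ x, x ∈ G.1 ↔ (x ∈ U.1 ∧ t ≤ x) ∧ ∀ y, y ∈ G.1 → y < x → ∀ r, pr r t ∈ Lt.1 → r ≠ t →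
        (r ≤ y ∨ pr (pr t y) r ∈ S.1) → pr x r ∈ H.1) ∧
      (t ∈ c.1 ↔ ∀ a, ∃ x, a < x ∧ x ∈ G.1 ∧ ∃ u, pr (pr t x) u ∈ S.1 ∧ (u ∈ K.1 ∨ u ∈ c.1)) ∧
      ∀ x, pr x t ∈ H.1 ↔
        x ∈ G.1 ∧ ((∃ u, pr (pr t x) u ∈ S.1 ∧ (u ∈ K.1 ∨ u ∈ c.1)) ↔ t ∈ c.1))
    (t : M.num) (ht : pr t t ∈ Lt.1) :
    (∀ a, ∃ x, a < x ∧ pr x t ∈ H.1) ∧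
      ∀ r, pr r t ∈ Lt.1 → r ≠ t → ∃ a, ∀ x, a < x → pr x t ∈ H.1 → pr x r ∈ H.1 := by
  have hHU : ∀ x r, pr r r ∈ Lt.1 → pr x r ∈ H.1 → x ∈ U.1 := by
    intro x r hr hx
    obtain ⟨G, hG, -, hH⟩ := h r hr
    exact ((hG x).1 ((hH x).1 hx).1).1.1
  refine hL.2.1.induction (P := fun t => (∀ a, ∃ x, a < x ∧ pr x t ∈ H.1) ∧
      ∀ r, pr r t ∈ Lt.1 → r ≠ t → ∃ a, ∀ x, a < x → pr x t ∈ H.1 → pr x r ∈ H.1)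
    (fun t ht ih => ?_) t ht
  obtain ⟨G, hG, hc, hH⟩ := h t ht
  -- Any bounded collection of earlier stages contains a last one, whose set is almost contained in
  -- all the others.
  have hlast : ∀ b, (∀ r, r < b → ¬ (pr r t ∈ Lt.1 ∧ r ≠ t)) ∨
      ∃ r₀, (pr r₀ t ∈ Lt.1 ∧ r₀ ≠ t) ∧ ∃ a₀, ∀ x, a₀ < x → pr x r₀ ∈ H.1 →
        ∀ r, r < b → pr r t ∈ Lt.1 ∧ r ≠ t → pr x r ∈ H.1 := by
    refine arith_induction (Or.inl fun r hr => (num_not_lt_zero r hr).elim) fun b hb => ?_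
    by_cases hbt : pr b t ∈ Lt.1 ∧ b ≠ t
    · right
      have hbb := (hL.1.1 _ _ hbt.1).1
      rcases hb with hb | ⟨r₀, hr₀, a₀, ha₀⟩
      · refine ⟨b, hbt, 0, fun x _ hx r hr hrt => ?_⟩
        rcases num_lt_succ.1 hr with hr | rfl
        · exact (hb r hr hrt).elim
        · exact hx
      · have hr₀₀ := (hL.1.1 _ _ hr₀.1).1
        by_cases hne : b = r₀
        · subst hne
          refine ⟨b, hbt, a₀, fun x hx hxb r hr hrt => ?_⟩
          rcases num_lt_succ.1 hr with hr | rfl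
          · exact ha₀ x hx hxb r hr hrt
          · exact hxb
        · rcases hL.2.2 b r₀ ⟨hbb, hr₀₀⟩ with hlt | hlt
          · obtain ⟨a₁, ha₁⟩ := (ih r₀ hr₀₀ hr₀.1 hr₀.2).2 b hlt hne
            refine ⟨r₀, hr₀, max a₀ a₁, fun x hx hxr r hr hrt => ?_⟩
            rcases num_lt_succ.1 hr with hr | rfl
            · exact ha₀ x ((le_max_left _ _).trans_lt hx) hxr r hr hrt
            · exact ha₁ x ((le_max_right _ _).trans_lt hx) hxr
          · obtain ⟨a₁, ha₁⟩ := (ih b hbb hbt.1 hbt.2).2 r₀ hlt (Ne.symm hne)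
            refine ⟨b, hbt, max a₀ a₁, fun x hx hxb r hr hrt => ?_⟩
            rcases num_lt_succ.1 hr with hr | rfl
            · exact ha₀ x ((le_max_left _ _).trans_lt hx)
                (ha₁ x ((le_max_right _ _).trans_lt hx) hxb) r hr hrt
            · exact hxb
    · rcases hb with hb | ⟨r₀, hr₀, a₀, ha₀⟩
      · refine Or.inl fun r hr hrt => ?_
        rcases num_lt_succ.1 hr with hr | rfl
        · exact hb r hr hrt
        · exact hbt hrt
      · refine Or.inr ⟨r₀, hr₀, a₀, fun x hx hxr r hr hrt => ?_⟩
        rcases num_lt_succ.1 hr with hr | rfl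
        · exact ha₀ x hx hxr r hr hrt
        · exact (hbt hrt).elim
  have hbound : ∀ b, ∃ d, ∀ y, y < b → ∀ r, pr (pr t y) r ∈ S.1 → r < d := by
    refine arith_induction ⟨0, fun y hy => (num_not_lt_zero y hy).elim⟩ ?_
    rintro b ⟨d, hd⟩
    by_cases hex : ∃ r, pr (pr t b) r ∈ S.1
    · obtain ⟨r₁, hr₁⟩ := hex
      refine ⟨max d (r₁ + 1), fun y hy r hr => ?_⟩
      rcases num_lt_succ.1 hy with hy | rfl
      · exact (hd y hy r hr).trans_le (le_max_left _ _)
      · rw [hSfun t y r r₁ hr hr₁]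
        exact (num_lt_succ.2 (Or.inr rfl)).trans_le (le_max_right _ _)
    · refine ⟨d, fun y hy r hr => ?_⟩
      rcases num_lt_succ.1 hy with hy | rfl
      · exact hd y hy r hr
      · exact (hex ⟨r, hr⟩).elim
  have hGinf : ∀ a, ∃ x, a < x ∧ x ∈ G.1 := by
    intro a
    by_contra hcon
    push Not at hcon
    obtain ⟨d, hd⟩ := hbound (a + 1)
    obtain ⟨x, hax, htx, hxU, hx⟩ : ∃ x, a < x ∧ t ≤ x ∧ x ∈ U.1 ∧
        ∀ r, r < max d (a + 1) → pr r t ∈ Lt.1 ∧ r ≠ t → pr x r ∈ H.1 := by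
      rcases hlast (max d (a + 1)) with hnone | ⟨r₀, hr₀, a₀, ha₀⟩
      · obtain ⟨x, hx, hxU⟩ := hU (max a t)
        exact ⟨x, (le_max_left _ _).trans_lt hx, ((le_max_right _ _).trans_lt hx).le, hxU,
          fun r hr hrt => (hnone r hr hrt).elim⟩
      · have hr₀₀ := (hL.1.1 _ _ hr₀.1).1
        obtain ⟨x, hx, hxr⟩ := (ih r₀ hr₀₀ hr₀.1 hr₀.2).1 (max a₀ (max a t))
        have hx' : max a t < x := (le_max_right _ _).trans_lt hx
        exact ⟨x, (le_max_left _ _).trans_lt hx', ((le_max_right _ _).trans_lt hx').le,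
          hHU x r₀ hr₀₀ hxr, ha₀ x ((le_max_left _ _).trans_lt hx) hxr⟩
    refine hcon x hax ((hG x).2 ⟨⟨hxU, htx⟩, fun y hy _ r hrt hne hr => hx r ?_ ⟨hrt, hne⟩⟩)
    have hya : y ≤ a := not_lt.1 fun hay => hcon y hay hy
    rcases hr with hr | hr
    · exact (lt_succ_iff.2 (hr.trans hya)).trans_le (le_max_right _ _)
    · exact (hd y (lt_succ_iff.2 hya) r hr).trans_le (le_max_left _ _)
  refine ⟨fun a => ?_, fun r hrt hne => ?_⟩
  · by_cases hct : t ∈ c.1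
    · obtain ⟨x, hax, hxG, hx⟩ := hc.1 hct a
      exact ⟨x, hax, (hH x).2 ⟨hxG, iff_of_true hx hct⟩⟩
    · have hct' := mt hc.2 hct
      push Not at hct'
      obtain ⟨a₁, ha₁⟩ := hct'
      obtain ⟨x, hx, hxG⟩ := hGinf (max a a₁)
      refine ⟨x, (le_max_left _ _).trans_lt hx, (hH x).2 ⟨hxG, iff_of_false ?_ hct⟩⟩
      rintro ⟨u, hu, hu'⟩
      have := ha₁ x ((le_max_right _ _).trans_lt hx) hxG u hu
      tauto
  · obtain ⟨y, hy, hyG⟩ := hGinf r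
    exact ⟨y, fun x hyx hx => ((hG x).1 ((hH x).1 hx).1).2 y hyG hyx r hrt hne (Or.inl hy.le)⟩

/-- The finite set coded by `s` is an initial segment of `X`. -/
def InitSeg (s : M.num) (X : Set M.num) : Prop := ∃ b, ∀ i, FinMem i s ↔ i ∈ X ∧ i < b

/-- The finite set coded by `s` is an initial segment of the finite set coded by `t`. -/
def FinSeg (s t : M.num) : Prop := ∃ b, ∀ i, FinMem i s ↔ FinMem i t ∧ i < b

instance {t v : M.num → M.num} [ArithFun t] [ArithFun v] :
    ArithPred fun x => FinSeg (t x) (v x) :=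
  ArithPred.comp₂ (by unfold FinSeg; infer_instance) t v

theorem finCode_zero : FinCode (0 : M.num) := fun t ht => (num_not_lt_zero t ht).elim

theorem not_finMem_zero (i : M.num) : ¬ FinMem i 0 := fun h => num_not_lt_zero i h.lt

/-- The clopen Ramsey theorem: let `D` be a set of finite sets such that any infinite subset of `U`
has an initial segment in `D`, and let `D` be coloured according to membership in `K`. Then there is
an infinite `W ⊆ U` such that all infinite subsets of `W` have an initial segment in `D` of the same
colour. The recursion of `exists_ramsey_hierarchy` is applied to the tree of finite subsets of `U`
without initial segment in `D`, with the Kleene-Brouwer order, and `W` is its last set. -/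
theorem clopen_ramsey {U D K : M.sets} (hU : Unbounded U.1) (hDcode : ∀ t, t ∈ D.1 → FinCode t)
    (hD : ∀ X : M.sets, Unbounded X.1 → X.1 ⊆ U.1 → ∃ t, t ∈ D.1 ∧ InitSeg t X.1) :
    ∃ W : M.sets, Unbounded W.1 ∧ W.1 ⊆ U.1 ∧
      ((∀ X : M.sets, Unbounded X.1 → X.1 ⊆ W.1 → ∃ t, t ∈ D.1 ∧ InitSeg t X.1 ∧ t ∈ K.1) ∨
       (∀ X : M.sets, Unbounded X.1 → X.1 ⊆ W.1 → ∃ t, t ∈ D.1 ∧ InitSeg t X.1 ∧ t ∉ K.1)) := by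
  let T : M.sets := setOf fun t => FinCode t ∧ (∀ i, FinMem i t → i ∈ U.1) ∧
    ∀ u, u ∈ D.1 → ¬ FinSeg u t
  let FM : M.sets := relOf fun t i => FinMem i t
  let S : M.sets := relOf fun w u => fst w ≤ snd w ∧ FinCode u ∧
    ∀ i, FinMem i u ↔ FinMem i (fst w) ∨ i = snd w
  let Lt : M.sets := lexOrd T FM
  have hS : ∀ t x u, pr (pr t x) u ∈ S.1 ↔ t ≤ x ∧ FinCode u ∧
      ∀ i, FinMem i u ↔ FinMem i t ∨ i = x := by
    intro t x u
    simp only [S, mem_relOf, fst_pr, snd_pr]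
  have hFM : ∀ t i, pr t i ∈ FM.1 ↔ FinMem i t := fun t i => mem_relOf
  have hLt : IsWellOrd Lt := by
    refine isWellOrd_lexOrd (fun a b ha hb hab => ?_) fun X hX hpath => ?_
    · simp only [hFM] at hab
      exact ha.1.ext hb.1 hab
    · simp only [hFM] at hpath
      have hXU : X.1 ⊆ U.1 := fun x hx => by
        obtain ⟨a, ha, hax⟩ := hpath x
        exact ha.2.1 x ((hax x le_rfl).2 hx)
      obtain ⟨t, htD, b, ht⟩ := hD X hX hXU
      obtain ⟨a, ha, hab⟩ := hpath b
      refine ha.2.2 t htD ⟨b, fun i => (ht i).trans ?_⟩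
      exact ⟨fun h => ⟨(hab i h.2.le).2 h.1, h.2⟩, fun h => ⟨(hab i h.2.le).1 h.1, h.2⟩⟩
  by_cases h0T : (0 : M.num) ∈ T.1
  swap
  · -- The empty set belongs to `D`, and it is an initial segment of all sets.
    have : ∃ u, u ∈ D.1 ∧ FinSeg u 0 := by
      by_contra hcon
      push Not at hcon
      exact h0T ⟨finCode_zero, fun i hi => (not_finMem_zero i hi).elim, hcon⟩
    obtain ⟨u, huD, b, hu⟩ := this
    have hseg : ∀ X : M.sets, InitSeg u X.1 := fun X => ⟨0, fun i => iff_of_false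
      (fun h => not_finMem_zero i ((hu i).1 h).1) fun h => num_not_lt_zero i h.2⟩
    refine ⟨U, hU, subset_rfl, ?_⟩
    by_cases huK : u ∈ K.1
    · exact Or.inl fun X _ _ => ⟨u, huD, hseg X, huK⟩
    · exact Or.inr fun X _ _ => ⟨u, huD, hseg X, huK⟩
  have hself : ∀ t, pr t t ∈ Lt.1 ↔ t ∈ T.1 := fun t => mem_lexOrd_self
  have hSlt : ∀ t x u, pr (pr t x) u ∈ S.1 → pr t t ∈ Lt.1 → pr u u ∈ Lt.1 →
      pr u t ∈ Lt.1 ∧ u ≠ t := by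
    intro t x u hu ht hu'
    obtain ⟨htx, -, hu⟩ := (hS t x u).1 hu
    have hlex : LexLt FM u t := by
      refine ⟨x, (hFM _ _).2 ((hu x).2 (Or.inr rfl)), fun h => ?_, fun y hy => ?_⟩
      · exact absurd ((hFM _ _).1 h).lt (not_lt.2 htx)
      · rw [hFM, hFM, hu y]
        exact or_iff_left hy.ne
    refine ⟨mem_lexOrd.2 ⟨(hself u).1 hu', (hself t).1 ht, Or.inr hlex⟩, ?_⟩
    rintro rfl
    exact hlex.irrefl
  obtain ⟨H, c, hcT, hH⟩ := exists_ramsey_hierarchy (U := U)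
    (K := setOf fun u => u ∈ K.1 ∧ u ∉ T.1) hLt hSlt
  have hinf := (ramsey_hierarchy_unbounded hLt hU (fun t x u u' hu hu' => by
    rw [hS] at hu hu'
    exact hu.2.1.ext hu'.2.1 fun i => (hu.2.2 i).trans (hu'.2.2 i).symm) hH 0
    ((hself 0).2 h0T)).1
  let W : M.sets := setOf fun x => pr x 0 ∈ H.1
  have hWU : W.1 ⊆ U.1 := fun x hx => by
    obtain ⟨G, hG, -, hG'⟩ := hH 0 ((hself 0).2 h0T)
    exact ((hG x).1 ((hG' x).1 hx).1).1.1
  refine ⟨W, hinf, hWU, ?_⟩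
  suffices hmain : ∀ X : M.sets, Unbounded X.1 → X.1 ⊆ W.1 →
      ∃ t, t ∈ D.1 ∧ InitSeg t X.1 ∧ (t ∈ K.1 ↔ 0 ∈ c.1) by
    by_cases h0 : 0 ∈ c.1
    · refine Or.inl fun X hX hXW => ?_
      obtain ⟨t, h1, h2, h3⟩ := hmain X hX hXW
      exact ⟨t, h1, h2, h3.2 h0⟩
    · refine Or.inr fun X hX hXW => ?_
      obtain ⟨t, h1, h2, h3⟩ := hmain X hX hXW
      exact ⟨t, h1, h2, fun h => h0 (h3.1 h)⟩
  intro X hX hXW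
  choose part hcode hpart using fun a => exists_code (fun i => i ∈ X.1) a
  have hpart0 : part 0 = 0 := (hcode 0).ext finCode_zero fun i =>
    iff_of_false (fun h => num_not_lt_zero i ((hpart 0 i).1 h).2) (not_finMem_zero i)
  have hskip : ∀ a, a ∉ X.1 → part (a + 1) = part a := fun a ha =>
    (hcode _).ext (hcode _) fun i => by
      rw [hpart, hpart, num_lt_succ]
      refine and_congr_right fun hi => or_iff_left ?_
      rintro rfl
      exact ha hi
  have hstep : ∀ a i, a ∈ X.1 → (FinMem i (part (a + 1)) ↔ FinMem i (part a) ∨ i = a) := by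
    intro a i ha
    rw [hpart, hpart, num_lt_succ]
    constructor
    · rintro ⟨h1, h2 | rfl⟩
      exacts [Or.inl ⟨h1, h2⟩, Or.inr rfl]
    · rintro (⟨h1, h2⟩ | rfl)
      exacts [⟨h1, Or.inl h2⟩, ⟨ha, Or.inr rfl⟩]
  have hdown : ∀ a, part (a + 1) ∈ T.1 → part a ∈ T.1 := by
    intro a hT
    refine ⟨hcode a, fun i hi => hWU (hXW ((hpart a i).1 hi).1), fun u huD hu => ?_⟩
    obtain ⟨b, hb⟩ := hu
    refine hT.2.2 u huD ⟨min a b, fun i => ?_⟩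
    rw [hb i, hpart, hpart, num_lt_succ, lt_min_iff]
    tauto
  -- Along `X`, the colour does not change, and the rest of `X` remains in the relevant set.
  have hcolour : ∀ a, ∀ z, pr z (part a) ∈ H.1 →
      ((∃ u, pr (pr (part a) z) u ∈ S.1 ∧ ((u ∈ K.1 ∧ u ∉ T.1) ∨ u ∈ c.1)) ↔ part a ∈ c.1) ∧
        part a ≤ z ∨ part a ∉ T.1 := by
    intro a z hz
    by_cases hT : part a ∈ T.1
    · obtain ⟨G, hG, -, hG'⟩ := hH (part a) ((hself _).2 hT)
      obtain ⟨h1, h2⟩ := (hG' z).1 hz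
      exact Or.inl ⟨h2, ((hG z).1 h1).1.2⟩
    · exact Or.inr hT
  have hsucc : ∀ a, a ∈ X.1 → part a ∈ T.1 → pr a (part a) ∈ H.1 →
      pr (pr (part a) a) (part (a + 1)) ∈ S.1 ∧
        (((part (a + 1) ∈ K.1 ∧ part (a + 1) ∉ T.1) ∨ part (a + 1) ∈ c.1) ↔ part a ∈ c.1) := by
    intro a ha hT haH
    rcases hcolour a a haH with ⟨h1, h2⟩ | h
    · have hmem : pr (pr (part a) a) (part (a + 1)) ∈ S.1 :=
        (hS _ _ _).2 ⟨h2, hcode _, fun i => hstep a i ha⟩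
      refine ⟨hmem, ?_⟩
      rw [← h1]
      refine ⟨fun h => ⟨_, hmem, h⟩, ?_⟩
      rintro ⟨u, hu, h⟩
      obtain ⟨-, h3, h4⟩ := (hS _ _ _).1 hu
      rwa [← h3.ext (hcode (a + 1)) fun i => (h4 i).trans (hstep a i ha).symm]
    · exact (h hT).elim
  have hwalk : ∀ a, ∀ t, FinCode t → (∀ i, FinMem i t ↔ i ∈ X.1 ∧ i < a) → t ∈ T.1 →
      (∀ z, z ∈ X.1 → a ≤ z → pr z t ∈ H.1) ∧ (t ∈ c.1 ↔ 0 ∈ c.1) := by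
    refine arith_induction (fun t ht ht' _ => ?_) fun a ih t ht ht' hT => ?_
    · obtain rfl : t = 0 := ht.ext finCode_zero fun i => iff_of_false
        (fun h => num_not_lt_zero i ((ht' i).1 h).2) (not_finMem_zero i)
      exact ⟨fun z hz _ => hXW hz, Iff.rfl⟩
    · obtain rfl : t = part (a + 1) := ht.ext (hcode _) fun i => (ht' i).trans (hpart _ i).symm
      obtain ⟨h1, h2⟩ := ih (part a) (hcode a) (hpart a) (hdown a hT)
      by_cases haX : a ∈ X.1
      · obtain ⟨h3, h4⟩ := hsucc a haX (hdown a hT) (h1 a haX le_rfl)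
        refine ⟨fun z hz haz => ?_, ?_⟩
        · obtain ⟨G, hG, -, hG'⟩ := hH (part a) ((hself _).2 (hdown a hT))
          have haz' : a < z := succ_le_iff'.1 haz
          obtain ⟨h5, h6⟩ := hSlt _ _ _ h3 ((hself _).2 (hdown a hT)) ((hself _).2 hT)
          exact ((hG z).1 ((hG' z).1 (h1 z hz haz'.le)).1).2 a ((hG' a).1 (h1 a haX le_rfl)).1 haz'
            _ h5 h6 (Or.inr h3)
        · rw [← h2, ← h4]
          tauto
      · rw [hskip a haX]
        exact ⟨fun z hz haz => h1 z hz ((succ_le_iff'.1 haz).le), h2⟩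
  obtain ⟨d, hdD, b, hd⟩ := hD X hX (hXW.trans hWU)
  obtain ⟨a, ⟨t, htc, ht, htT⟩, hmin⟩ := arith_least
    (P := fun a => ∃ t, FinCode t ∧ (∀ i, FinMem i t ↔ i ∈ X.1 ∧ i < a) ∧ t ∉ T.1) (a := b)
    ⟨part b, hcode b, hpart b, fun hT => hT.2.2 d hdD ⟨b, fun i => by
      rw [hd i, hpart]; tauto⟩⟩
  obtain rfl : t = part a := htc.ext (hcode _) fun i => (ht i).trans (hpart _ i).symm
  rcases num_zero_or_succ a with rfl | ⟨a, rfl⟩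
  · exact (htT (by rw [hpart0]; exact h0T)).elim
  have hT' : part a ∈ T.1 := by
    by_contra hcon
    exact hmin a (num_lt_succ.2 (Or.inr rfl)) ⟨_, hcode a, hpart a, hcon⟩
  have haX : a ∈ X.1 := by
    by_contra hcon
    exact htT (hskip a hcon ▸ hT')
  obtain ⟨h1, h2⟩ := hwalk a (part a) (hcode a) (hpart a) hT'
  obtain ⟨-, h3⟩ := hsucc a haX hT' (h1 a haX le_rfl)
  have htD : part (a + 1) ∈ D.1 := by
    by_contra hcon
    refine htT ⟨hcode _, fun i hi => hWU (hXW ((hpart _ i).1 hi).1), fun u huD hu => ?_⟩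
    obtain ⟨e, he⟩ := hu
    by_cases hae : a < e
    · refine hcon ?_
      rwa [← (hDcode u huD).ext (hcode (a + 1)) fun i => ?_]
      rw [he i]
      refine and_iff_left_of_imp fun hi => ?_
      exact (lt_succ_iff.1 ((hpart _ i).1 hi).2).trans_lt hae
    · refine hT'.2.2 u huD ⟨e, fun i => ?_⟩
      rw [he i, hstep a i haX]
      refine and_congr_left fun hi => or_iff_left ?_
      rintro rfl
      exact hae hi
  refine ⟨part (a + 1), htD, ⟨a + 1, hpart _⟩, ?_⟩
  rw [← h2, ← h3]
  have : part (a + 1) ∉ c.1 := fun h => htT ((hself _).1 (hcT _ h))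
  tauto

end Ramsey

/-! ### Blocks and arrays in a model -/

section Arrays

variable {M : Str.{u}} [hM : M.IsATR]

/-- `X ∈ [V]^ω` -/
def IsInfSub (X V : M.sets) : Prop := Unbounded X.1 ∧ ∀ x, x ∈ X.1 → x ∈ V.1

/-- `Y = X⁻`, that is, `Y` is `X` without its least element. -/
def IsTail (X Y : M.sets) : Prop :=
  ∃ x, x ∈ X.1 ∧ (∀ y, y ∈ X.1 → ¬ y < x) ∧ ∀ n, n ∈ Y.1 ↔ n ∈ X.1 ∧ ¬ n = x

/-- `B` is a block with base `V`. -/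
def IsBlock (B V : M.sets) : Prop :=
  Unbounded V.1 ∧
  (∀ s, s ∈ B.1 → FinCode s ∧ (∃ i, FinMem i s) ∧ ∀ i, FinMem i s → i ∈ V.1) ∧
  ∀ X : M.sets, IsInfSub X V →
    ∃ s, s ∈ B.1 ∧ InitSeg s X.1 ∧ ∀ t, t ∈ B.1 ∧ InitSeg t X.1 → t = s

/-- `f` is the graph of a function from `B` to `Q`. -/
def IsFunction (f B Q : M.sets) : Prop :=
  (∀ z, z ∈ f.1 → ∃ s q, z = pr s q ∧ s ∈ B.1 ∧ q ∈ Q.1) ∧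
  ∀ s, s ∈ B.1 → ∃ q, pr s q ∈ f.1 ∧ ∀ r, pr s r ∈ f.1 → r = q

/-- `f` is a `Q`-array with domain `[V]^ω`, given as a function on a block. -/
def IsArray (f V Q : M.sets) : Prop := ∃ B : M.sets, IsBlock B V ∧ IsFunction f B Q

/-- The array `f` has value `q` at `X`. -/
def Value (f X : M.sets) (q : M.num) : Prop := ∃ s, pr s q ∈ f.1 ∧ InitSeg s X.1

/-- `f` is an `R`-bad array with domain `[V]^ω`. -/
def IsBadArray (f V Q R : M.sets) : Prop :=
  IsArray f V Q ∧ ∀ X Y : M.sets, IsInfSub X V ∧ IsTail X Y →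
    ∀ p q, Value f X p ∧ Value f Y q → ¬ pr p q ∈ R.1

/-- The array `f` with domain `[V]^ω` lies below the array `g` with domain `[W]^ω`. -/
def ArrayLt (f V g W le : M.sets) : Prop :=
  (∀ x, x ∈ V.1 → x ∈ W.1) ∧ ∀ X : M.sets, IsInfSub X V →
    ∀ p q, Value f X p ∧ Value g X q → pr p q ∈ le.1 ∧ ¬ p = q

/-- `g` is a `le`-minimal `R`-bad array with domain `[W]^ω`. -/
def IsMinimalBad (g W Q le R : M.sets) : Prop :=
  IsBadArray g W Q R ∧ ¬ ∃ V f : M.sets, IsBadArray f V Q R ∧ ArrayLt f V g W le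

/-- `h` is the restriction of the array `f` to `[W]^ω`. -/
def IsRestriction (h W f : M.sets) : Prop :=
  ∀ X : M.sets, IsInfSub X W → ∀ q, Value h X q ↔ Value f X q

omit hM in
theorem IsInfSub.trans {X W V : M.sets} (h : IsInfSub X W) (h' : IsInfSub W V) : IsInfSub X V :=
  ⟨h.1, fun x hx => h'.2 x (h.2 x hx)⟩

theorem exists_isTail {X : M.sets} (hX : Unbounded X.1) : ∃ Y, IsTail X Y := by
  obtain ⟨a, -, ha⟩ := hX 0
  obtain ⟨x, hx, hmin⟩ := arith_least (P := fun x => x ∈ X.1) ha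
  exact ⟨setOf fun n => n ∈ X.1 ∧ ¬ n = x, x, hx, fun y hy hyx => hmin y hyx hy, fun n => Iff.rfl⟩

theorem IsTail.isInfSub {X Y : M.sets} (h : IsTail X Y) (hX : Unbounded X.1) : IsInfSub Y X := by
  obtain ⟨x, hx, -, h⟩ := h
  refine ⟨fun a => ?_, fun n hn => ((h n).1 hn).1⟩
  obtain ⟨b, hb, hbX⟩ := hX (max a x)
  exact ⟨b, (le_max_left _ _).trans_lt hb, (h b).2 ⟨hbX, ((le_max_right _ _).trans_lt hb).ne'⟩⟩

omit hM in
theorem IsArray.exists_value {f V Q X : M.sets} (hf : IsArray f V Q) (hX : IsInfSub X V) :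
    ∃ q, Value f X q := by
  obtain ⟨B, hB, hfB⟩ := hf
  obtain ⟨s, hs, hsX, -⟩ := hB.2.2 X hX
  obtain ⟨q, hq, -⟩ := hfB.2 s hs
  exact ⟨q, s, hq, hsX⟩

theorem IsFunction.mem {f B Q : M.sets} (h : IsFunction f B Q) {s q : M.num}
    (hsq : pr s q ∈ f.1) : s ∈ B.1 ∧ q ∈ Q.1 := by
  obtain ⟨s', q', h1, h2⟩ := h.1 _ hsq
  obtain ⟨rfl, rfl⟩ := pr_inj.1 h1
  exact h2

theorem IsFunction.unique {f B Q : M.sets} (h : IsFunction f B Q) {s q r : M.num}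
    (hq : pr s q ∈ f.1) (hr : pr s r ∈ f.1) : q = r := by
  obtain ⟨q', -, h'⟩ := h.2 s (h.mem hq).1
  exact (h' q hq).trans (h' r hr).symm

omit hM in
theorem IsBlock.unique {B V X : M.sets} (h : IsBlock B V) (hX : IsInfSub X V) {s t : M.num}
    (hs : s ∈ B.1) (hsX : InitSeg s X.1) (ht : t ∈ B.1) (htX : InitSeg t X.1) : s = t := by
  obtain ⟨r, -, -, h'⟩ := h.2.2 X hX
  exact (h' s ⟨hs, hsX⟩).trans (h' t ⟨ht, htX⟩).symm

theorem IsArray.value_mem {f V Q X : M.sets} (hf : IsArray f V Q) {q : M.num}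
    (h : Value f X q) : q ∈ Q.1 := by
  obtain ⟨B, -, hfB⟩ := hf
  obtain ⟨s, hs, -⟩ := h
  exact (hfB.mem hs).2

theorem exists_restriction {f V Q W : M.sets} (hf : IsArray f V Q) (hW : IsInfSub W V) :
    ∃ h, IsRestriction h W f ∧ IsArray h W Q := by
  obtain ⟨B, hB, hfB⟩ := hf
  let B' : M.sets := setOf fun s => s ∈ B.1 ∧ ∀ i, FinMem i s → i ∈ W.1
  let h : M.sets := relOf fun s q => pr s q ∈ f.1 ∧ s ∈ B'.1
  have hsub : ∀ X : M.sets, IsInfSub X W → ∀ s, s ∈ B.1 → InitSeg s X.1 → s ∈ B'.1 := by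
    rintro X hX s hs ⟨b, hb⟩
    exact ⟨hs, fun i hi => hX.2 i ((hb i).1 hi).1⟩
  refine ⟨h, fun X hX q => ⟨?_, ?_⟩, B', ⟨hW.1, fun s hs => ?_, fun X hX => ?_⟩,
    fun z hz => ?_, fun s hs => ?_⟩
  · rintro ⟨s, hs, hsX⟩
    exact ⟨s, (mem_relOf.1 hs).1, hsX⟩
  · rintro ⟨s, hs, hsX⟩
    exact ⟨s, mem_relOf.2 ⟨hs, hsub X hX s (hfB.mem hs).1 hsX⟩, hsX⟩
  · exact ⟨(hB.2.1 s hs.1).1, (hB.2.1 s hs.1).2.1, hs.2⟩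
  · obtain ⟨s, hs, hsX, huniq⟩ := hB.2.2 X (hX.trans hW)
    exact ⟨s, hsub X hX s hs hsX, hsX, fun t ht => huniq t ⟨ht.1.1, ht.2⟩⟩
  · obtain ⟨s, q, rfl, hsq, hs⟩ := mem_relOf'.1 hz
    exact ⟨s, q, rfl, hs, (hfB.mem hsq).2⟩
  · obtain ⟨q, hq, huniq⟩ := hfB.2 s hs.1
    exact ⟨q, mem_relOf.2 ⟨hq, hs⟩, fun r hr => huniq r (mem_relOf.1 hr).1⟩

/-- The finite set `t` is the union of an initial segment `s ∈ B` of `t` and an initial segment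
`s' ∈ B` of the set `t⁻` that results from `t` by removing the least element. For a block `B`, each
infinite subset `X` of the base has exactly one such initial segment `t`, and this determines the
values of arrays on `B` at `X` and `X⁻`. -/
def PairSeg (B : M.sets) (t s s' : M.num) : Prop :=
  FinCode t ∧ s ∈ B.1 ∧ s' ∈ B.1 ∧ FinSeg s t ∧
    (∃ x, FinMem x t ∧ (∀ y, FinMem y t → ¬ y < x) ∧
      ∃ b, ∀ i, FinMem i s' ↔ (FinMem i t ∧ ¬ i = x) ∧ i < b) ∧
    ∀ i, FinMem i t ↔ FinMem i s ∨ FinMem i s'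

set_option synthInstance.maxSize 1000 in
set_option synthInstance.maxHeartbeats 200000 in
instance {B : M.sets} {t v w : M.num → M.num} [ArithFun t] [ArithFun v] [ArithFun w] :
    ArithPred fun x => PairSeg B (t x) (v x) (w x) :=
  ArithPred.comp₃ (by unfold PairSeg; infer_instance) t v w

theorem exists_pairSeg {B V X Y : M.sets} (hB : IsBlock B V) (hXY : IsTail X Y) {s s' : M.num}
    (hs : s ∈ B.1) (hsX : InitSeg s X.1) (hs' : s' ∈ B.1) (hs'Y : InitSeg s' Y.1) :
    ∃ t, PairSeg B t s s' ∧ InitSeg t X.1 := by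
  obtain ⟨x, hx, hmin, hY⟩ := hXY
  obtain ⟨b, hb⟩ := hsX
  obtain ⟨b', hb'⟩ := hs'Y
  have hxb : x < b := by
    obtain ⟨i, hi⟩ := (hB.2.1 s hs).2.1
    have := (hb i).1 hi
    exact (not_lt.1 (hmin i this.1)).trans_lt this.2
  obtain ⟨t, htc, ht⟩ := exists_code (fun i => i ∈ X.1) (max b b')
  refine ⟨t, ⟨htc, hs, hs', ⟨b, fun i => ?_⟩, ⟨x, (ht x).2 ⟨hx, lt_max_of_lt_left hxb⟩,
    fun y hy => hmin y ((ht y).1 hy).1, b', fun i => ?_⟩, fun i => ?_⟩, max b b', ht⟩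
  · rw [hb i, ht i, lt_max_iff]
    tauto
  · rw [hb' i, ht i, hY i, lt_max_iff]
    tauto
  · rw [ht i, hb i, hb' i, hY i, lt_max_iff]
    by_cases hix : i = x
    · subst hix
      tauto
    · tauto

theorem PairSeg.initSeg {B X Y : M.sets} {t s s' : M.num} (h : PairSeg B t s s')
    (hXY : IsTail X Y) (ht : InitSeg t X.1) : InitSeg s X.1 ∧ InitSeg s' Y.1 := by
  obtain ⟨-, -, -, ⟨b, hb⟩, ⟨x, hx, hmin, b', hb'⟩, -⟩ := h
  obtain ⟨x₀, hx₀, hmin₀, hY⟩ := hXY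
  obtain ⟨c, hc⟩ := ht
  have hxX := (hc x).1 hx
  have hle : x₀ ≤ x := not_lt.1 (hmin₀ x hxX.1)
  obtain rfl : x = x₀ := le_antisymm
    (not_lt.1 (hmin x₀ ((hc x₀).2 ⟨hx₀, hle.trans_lt hxX.2⟩))) hle
  refine ⟨⟨min c b, fun i => ?_⟩, min c b', fun i => ?_⟩
  · rw [hb i, hc i, lt_min_iff]
    tauto
  · rw [hb' i, hc i, hY i, lt_min_iff]
    tauto

/-- The clopen Ramsey theorem for a property of the values `f(X)` and `f(X⁻)` of an array. -/
theorem IsArray.ramsey {f V Q U : M.sets} (hf : IsArray f V Q) (hU : IsInfSub U V)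
    (P : M.num → M.num → Prop) [hP : ArithPred fun z => P (fst z) (snd z)] :
    ∃ W, IsInfSub W U ∧
      ((∀ X Y : M.sets, IsInfSub X W → IsTail X Y →
          ∀ p q, Value f X p → Value f Y q → P p q) ∨
        ∀ X Y : M.sets, IsInfSub X W → IsTail X Y →
          ∀ p q, Value f X p → Value f Y q → ¬ P p q) := by
  obtain ⟨B, hB, hfB⟩ := hf
  have inst (t v : M.num → M.num) [ArithFun t] [ArithFun v] :
      ArithPred fun x => P (t x) (v x) := hP.comp₂ t v
  have instK : ArithPred fun t : M.num => ∃ s s' p q, PairSeg B t s s' ∧ pr s p ∈ f.1 ∧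
      pr s' q ∈ f.1 ∧ P p q := by
    refine ArithPred.exists (h := ArithPred.exists (h := ArithPred.exists (h := ArithPred.exists
      (h := ArithPred.and (h' := ArithPred.and (h' := ArithPred.and (h' := inst _ _)))))))
  obtain ⟨W, hW, hWU, hramsey⟩ := clopen_ramsey (U := U)
    (D := setOf fun t => ∃ s s', PairSeg B t s s')
    (K := setOf fun t => ∃ s s' p q, PairSeg B t s s' ∧ pr s p ∈ f.1 ∧ pr s' q ∈ f.1 ∧ P p q)
    hU.1 (fun t ⟨s, s', h⟩ => h.1) (fun X hX hXU => by
      have hXV : IsInfSub X V := IsInfSub.trans ⟨hX, fun x hx => hXU hx⟩ hU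
      obtain ⟨Y, hXY⟩ := exists_isTail hX
      obtain ⟨s, hs, hsX, -⟩ := hB.2.2 X hXV
      obtain ⟨s', hs', hs'Y, -⟩ := hB.2.2 Y ((hXY.isInfSub hX).trans hXV)
      obtain ⟨t, ht, htX⟩ := exists_pairSeg hB hXY hs hsX hs' hs'Y
      exact ⟨t, ⟨s, s', ht⟩, htX⟩)
  have hval : ∀ X Y : M.sets, IsInfSub X W → IsTail X Y → ∀ t s s', PairSeg B t s s' →
      InitSeg t X.1 → ∀ p q, Value f X p → Value f Y q → pr s p ∈ f.1 ∧ pr s' q ∈ f.1 := by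
    rintro X Y hX hXY t s s' h ht p q ⟨s₁, hs₁, hs₁X⟩ ⟨s₂, hs₂, hs₂Y⟩
    have hXV : IsInfSub X V := (hX.trans ⟨hW, fun x hx => hWU hx⟩).trans hU
    obtain ⟨h1, h2⟩ := h.initSeg hXY ht
    rw [hB.unique hXV h.2.1 h1 (hfB.mem hs₁).1 hs₁X,
      hB.unique ((hXY.isInfSub hX.1).trans hXV) h.2.2.1 h2 (hfB.mem hs₂).1 hs₂Y]
    exact ⟨hs₁, hs₂⟩
  refine ⟨W, ⟨hW, fun x hx => hWU hx⟩, ?_⟩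
  rcases hramsey with hr | hr
  · refine Or.inl fun X Y hX hXY p q hp hq => ?_
    obtain ⟨t, -, ht, s, s', p', q', hpair, hsp, hsq, h⟩ := hr X hX.1 fun x hx => hX.2 x hx
    obtain ⟨h1, h2⟩ := hval X Y hX hXY t s s' hpair ht p q hp hq
    rwa [hfB.unique h1 hsp, hfB.unique h2 hsq]
  · refine Or.inr fun X Y hX hXY p q hp hq hPpq => ?_
    obtain ⟨t, ⟨s, s', hpair⟩, ht, hK⟩ := hr X hX.1 fun x hx => hX.2 x hx
    obtain ⟨h1, h2⟩ := hval X Y hX hXY t s s' hpair ht p q hp hq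
    exact hK ⟨s, s', p, q, hpair, h1, h2, hPpq⟩

/-- If for all `X` there is a number `r` with a given arithmetical relation to `f(X)` and `f(X⁻)`,
then such numbers can be chosen as the values of an array. -/
theorem IsArray.exists_choice {f V Q W : M.sets} (hf : IsArray f V Q) (hW : IsInfSub W V)
    (P : M.num → M.num → M.num → Prop)
    [hP : ArithPred fun z => P (fst (fst z)) (snd (fst z)) (snd z)]
    (hex : ∀ X Y : M.sets, IsInfSub X W → IsTail X Y → ∀ p q, Value f X p → Value f Y q →
      ∃ r, r ∈ Q.1 ∧ P p q r) :
    ∃ g, IsArray g W Q ∧ ∀ X Y : M.sets, IsInfSub X W → IsTail X Y →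
      ∀ p q r, Value f X p → Value f Y q → Value g X r → P p q r := by
  obtain ⟨B, hB, hfB⟩ := hf
  let G : M.num → M.num → Prop := fun t r => (∀ i, FinMem i t → i ∈ W.1) ∧ r ∈ Q.1 ∧
    ∃ s s' p q, PairSeg B t s s' ∧ pr s p ∈ f.1 ∧ pr s' q ∈ f.1 ∧ P p q r
  have instG (t v : M.num → M.num) [ArithFun t] [ArithFun v] :
      ArithPred fun x => G (t x) (v x) := by
    refine ArithPred.comp₂ (ArithPred.and (h' := ArithPred.and (h' :=
      ArithPred.exists (h := ArithPred.exists (h := ArithPred.exists (h := ArithPred.exists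
      (h := ArithPred.and (h' := ArithPred.and (h' := ArithPred.and (h' := hP.comp₃ _ _ _))))))))))
      t v
  have instB : ArithPred fun t => ∃ r, G t r := ArithPred.exists (h := instG _ _)
  have instg : ArithPred fun z : M.num => G (fst z) (snd z) ∧
      ∀ r, r < snd z → ¬ G (fst z) r :=
    ArithPred.and (h := instG _ _) (h' := ArithPred.forall (h := ArithPred.imp (h' :=
      ArithPred.not (h := instG _ _))))
  let B' : M.sets := setOf fun t => ∃ r, G t r
  let g : M.sets := relOf fun t r => G t r ∧ ∀ r', r' < r → ¬ G t r'
  have hseg : ∀ X Y : M.sets, IsInfSub X W → IsTail X Y → ∀ t s s', PairSeg B t s s' →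
      InitSeg t X.1 → ∀ s₁ s₂, s₁ ∈ B.1 → s₂ ∈ B.1 → InitSeg s₁ X.1 → InitSeg s₂ Y.1 →
        s = s₁ ∧ s' = s₂ := by
    rintro X Y hX hXY t s s' h ht s₁ s₂ hs₁ hs₂ hs₁X hs₂Y
    obtain ⟨h1, h2⟩ := h.initSeg hXY ht
    exact ⟨hB.unique (hX.trans hW) h.2.1 h1 hs₁ hs₁X,
      hB.unique ((hXY.isInfSub hX.1).trans (hX.trans hW)) h.2.2.1 h2 hs₂ hs₂Y⟩
  refine ⟨g, ⟨B', ⟨hW.1, ?_, fun X hX => ?_⟩, fun z hz => ?_, ?_⟩, ?_⟩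
  · rintro t ⟨r, htW, -, s, s', -, -, hpair, -⟩
    obtain ⟨i, hi⟩ := (hB.2.1 s hpair.2.1).2.1
    exact ⟨hpair.1, ⟨i, (hpair.2.2.2.2.2 i).2 (Or.inl hi)⟩, htW⟩
  · obtain ⟨Y, hXY⟩ := exists_isTail hX.1
    obtain ⟨s, hs, hsX, -⟩ := hB.2.2 X (hX.trans hW)
    obtain ⟨s', hs', hs'Y, -⟩ := hB.2.2 Y ((hXY.isInfSub hX.1).trans (hX.trans hW))
    obtain ⟨t, hpair, b, ht⟩ := exists_pairSeg hB hXY hs hsX hs' hs'Y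
    obtain ⟨p, hp, -⟩ := hfB.2 s hs
    obtain ⟨q, hq, -⟩ := hfB.2 s' hs'
    obtain ⟨r, hrQ, hr⟩ := hex X Y hX hXY p q ⟨s, hp, hsX⟩ ⟨s', hq, hs'Y⟩
    refine ⟨t, ⟨r, fun i hi => hX.2 i ((ht i).1 hi).1, hrQ, s, s', p, q, hpair, hp, hq, hr⟩,
      ⟨b, ht⟩, ?_⟩
    rintro t' ⟨⟨r', -, -, s₁, s₂, -, -, hpair', -⟩, ht'⟩
    obtain ⟨rfl, rfl⟩ := hseg X Y hX hXY t' s₁ s₂ hpair' ht' s s' hs hs' hsX hs'Y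
    exact hpair'.1.ext hpair.1 fun i =>
      (hpair'.2.2.2.2.2 i).trans (hpair.2.2.2.2.2 i).symm
  · obtain ⟨t, r, rfl, hr, -⟩ := mem_relOf'.1 hz
    exact ⟨t, r, rfl, ⟨r, hr⟩, hr.2.1⟩
  · rintro t ⟨r, hr⟩
    obtain ⟨r, hr, hmin⟩ := arith_least (P := fun r => G t r) (h := instG (fun _ => t) _) hr
    refine ⟨r, mem_relOf.2 ⟨hr, hmin⟩, fun r' hr' => ?_⟩
    obtain ⟨h1, h2⟩ := mem_relOf.1 hr'
    exact le_antisymm (not_lt.1 fun h => h2 r h hr) (not_lt.1 fun h => hmin r' h h1)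
  · rintro X Y hX hXY p q r ⟨s, hsp, hsX⟩ ⟨s', hsq, hs'Y⟩ ⟨t, htr, ht⟩
    obtain ⟨⟨-, -, s₁, s₂, p', q', hpair, hp', hq', h⟩, -⟩ := mem_relOf.1 htr
    obtain ⟨rfl, rfl⟩ := hseg X Y hX hXY t s₁ s₂ hpair ht s s' (hfB.mem hsp).1 (hfB.mem hsq).1
      hsX hs'Y
    rwa [hfB.unique hsp hp', hfB.unique hsq hq']

/-- The values of an array cannot decrease along a well order at all steps from `X` to `X⁻`. -/
theorem IsArray.not_descending {f V Q L : M.sets} (hf : IsArray f V Q) (hL : IsWellFnd L)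
    (hdesc : ∀ X Y : M.sets, IsInfSub X V → IsTail X Y → ∀ p q, Value f X p → Value f Y q →
      pr p p ∈ L.1 ∧ pr q p ∈ L.1 ∧ q ≠ p) : False := by
  have hV : Unbounded V.1 := by
    obtain ⟨B, hB, -⟩ := hf
    exact hB.1
  let Va : M.num → M.sets := fun a => setOf fun i => i ∈ V.1 ∧ a ≤ i
  have hVa : ∀ a, IsInfSub (Va a) V := fun a => ⟨fun b => by
    obtain ⟨c, hc, hcV⟩ := hV (max a b)
    exact ⟨c, (le_max_right _ _).trans_lt hc, hcV, ((le_max_left _ _).trans_lt hc).le⟩,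
    fun x hx => hx.1⟩
  let A : M.sets := setOf fun p => ∃ a s, pr s p ∈ f.1 ∧
    ∃ b, ∀ i, FinMem i s ↔ (i ∈ V.1 ∧ a ≤ i) ∧ i < b
  have hA : ∀ p, p ∈ A.1 ↔ ∃ a, Value f (Va a) p := fun p => Iff.rfl
  have hstep : ∀ a p, Value f (Va a) p → pr p p ∈ L.1 ∧ ∃ q, q ∈ A.1 ∧ pr q p ∈ L.1 ∧ q ≠ p := by
    intro a p hp
    obtain ⟨Y, hY⟩ := exists_isTail (hVa a).1
    obtain ⟨q, hq⟩ := hf.exists_value ((hY.isInfSub (hVa a).1).trans (hVa a))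
    obtain ⟨h1, h2⟩ := hdesc _ Y (hVa a) hY p q hp hq
    refine ⟨h1, q, (hA q).2 ?_, h2⟩
    obtain ⟨x, hx, hmin, hY⟩ := hY
    refine ⟨x + 1, ?_⟩
    obtain rfl : Y = Va (x + 1) := by
      refine Subtype.ext (Set.ext fun n => (hY n).trans ⟨fun h => ⟨h.1.1, ?_⟩, fun h => ?_⟩)
      · exact succ_le_iff'.2 (lt_of_le_of_ne (not_lt.1 (hmin n h.1)) (Ne.symm h.2))
      · have := succ_le_iff'.1 h.2
        exact ⟨⟨h.1, hx.2.trans this.le⟩, this.ne'⟩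
    exact hq
  obtain ⟨p, hp⟩ := hf.exists_value (hVa 0)
  obtain ⟨m, hm, -, hmin⟩ := hL A ⟨p, (hA p).2 ⟨0, hp⟩, (hstep 0 p hp).1⟩
  obtain ⟨a, ha⟩ := (hA m).1 hm
  obtain ⟨-, q, hq, hqm, hne⟩ := hstep a m ha
  exact hne (hmin q ⟨hq, hqm⟩)

/-- The statement of the theorem, for the sets of the model `M`. -/
theorem exists_order_of_partialRanking {Q R le' : M.sets} (hR : IsReflOn R Q)
    (hle : IsWfPartialOrdOn le' Q)
    (hrank : ∀ p q r, pr p q ∈ R.1 ∧ pr q r ∈ le'.1 → pr p r ∈ R.1) :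
    ∃ leQ : M.sets, IsWfPartialOrdOn leQ Q ∧ (∀ z, z ∈ le'.1 → z ∈ leQ.1) ∧
      (∀ z, z ∈ leQ.1 → z ∈ R.1) ∧
      ∀ V f : M.sets, IsMinimalBad f V Q leQ leQ →
        ∃ W, IsInfSub W V ∧ ∃ h, IsRestriction h W f ∧ IsBadArray h W Q R := by
  obtain ⟨L, hL, hLQ, hL'⟩ := exists_linear_extension hle
  obtain ⟨leQ, hQ, hsub, hsub', hwit⟩ := exists_pouzet_order hR hle hrank hL hLQ hL'
  refine ⟨leQ, hQ, hsub, hsub', fun V f ⟨⟨hf, hbad⟩, hmin⟩ => ?_⟩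
  have hV : IsInfSub V V := by
    obtain ⟨B, hB, -⟩ := hf
    exact ⟨hB.1, fun x hx => hx⟩
  suffices hW : ∃ W, IsInfSub W V ∧ ∀ X Y : M.sets, IsInfSub X W → IsTail X Y →
      ∀ p q, Value f X p → Value f Y q → ¬ pr p q ∈ R.1 by
    obtain ⟨W, hW, hWR⟩ := hW
    obtain ⟨h, hres, hh⟩ := exists_restriction hf hW
    refine ⟨W, hW, h, hres, hh, fun X Y hXY p q hpq => hWR X Y hXY.1 hXY.2 p q ?_ ?_⟩
    · exact (hres X hXY.1 p).1 hpq.1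
    · exact (hres Y ((hXY.2.isInfSub hXY.1.1).trans hXY.1) q).1 hpq.2
  obtain ⟨W₁, hW₁, h₁ | h₁⟩ := hf.ramsey hV
    (fun p q => pr p q ∈ R.1 ∧ pr p q ∈ L.1 ∧ p ≠ q)
  · -- The witnesses for the failure of `f(X) ≤_Q f(X⁻)` form a smaller bad array.
    obtain ⟨g, hg, hgP⟩ := hf.exists_choice hW₁
      (fun p q r => pr r p ∈ leQ.1 ∧ ¬ pr r q ∈ R.1) (fun X Y hX hXY p q hp hq => by
        obtain ⟨-, h2, h3⟩ := h₁ X Y hX hXY p q hp hq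
        obtain ⟨r, hr, hr'⟩ := hwit p q h2 h3
          (hbad X Y ⟨hX.trans hW₁, hXY⟩ p q ⟨hp, hq⟩)
        exact ⟨r, (hQ.1.mem hr).1, hr, hr'⟩)
    refine (hmin ⟨W₁, g, ⟨hg, fun X Y hXY p q hpq hle => ?_⟩, hW₁.2, fun X hX r p hrp => ?_⟩).elim
    · have hXV := hXY.1.trans hW₁
      have hYX := hXY.2.isInfSub hXY.1.1
      obtain ⟨p', hp'⟩ := hf.exists_value hXV
      obtain ⟨q', hq'⟩ := hf.exists_value (hYX.trans hXV)
      obtain ⟨Z, hZ⟩ := exists_isTail hYX.1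
      obtain ⟨r', hr'⟩ := hf.exists_value ((hZ.isInfSub hYX.1).trans (hYX.trans hXV))
      obtain ⟨-, h2⟩ := hgP X Y hXY.1 hXY.2 p' q' p hp' hq' hpq.1
      obtain ⟨h3, -⟩ := hgP Y Z (hYX.trans hXY.1) hZ q' r' q hq' hr' hpq.2
      exact h2 (hsub' _ (hQ.2.1.2.2 p q q' ⟨hle, h3⟩))
    · obtain ⟨Y, hXY⟩ := exists_isTail hX.1
      obtain ⟨q, hq⟩ := hf.exists_value ((hXY.isInfSub hX.1).trans (hX.trans hW₁))
      obtain ⟨h2, h3⟩ := hgP X Y hX hXY p q r hrp.2 hq hrp.1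
      refine ⟨h2, ?_⟩
      rintro rfl
      exact h3 (h₁ X Y hX hXY r q hrp.2 hq).1
  · obtain ⟨W₂, hW₂, h₂ | h₂⟩ := hf.ramsey hW₁ (fun p q => pr p q ∈ R.1)
    · obtain ⟨h, hres, hh⟩ := exists_restriction hf (hW₂.trans hW₁)
      refine (hh.not_descending hL.2.1 fun X Y hX hXY p q hp hq => ?_).elim
      have hYX := hXY.isInfSub hX.1
      have hp' := (hres X hX p).1 hp
      have hq' := (hres Y (hYX.trans hX) q).1 hq
      have hpL := (hLQ p).2 (hf.value_mem hp')
      have hqL := (hLQ q).2 (hf.value_mem hq')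
      have hne : p ≠ q := by
        rintro rfl
        exact hbad X Y ⟨(hX.trans hW₂).trans hW₁, hXY⟩ p p ⟨hp', hq'⟩
          (hQ.1.2 p (hf.value_mem hp'))
      refine ⟨hpL, (hL.2.2 p q ⟨hpL, hqL⟩).resolve_left fun hpq => ?_, hne.symm⟩
      exact h₁ X Y (hX.trans hW₂) hXY p q hp' hq' ⟨h₂ X Y hX hXY p q hp' hq', hpq, hne⟩
    · exact ⟨W₂, hW₂.trans hW₁, h₂⟩

end Arrays

end SecondOrderArithmetic

theorem proposition2p2 :
    SecondOrderArithmetic.Entails.{u} SecondOrderArithmetic.ATR0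
      SecondOrderArithmetic.pouzetSentence := by
  intro M hM e s
  have : M.IsATR := ⟨hM⟩
  have h : ∀ Q R le' : M.sets, _ := fun Q R le' =>
    @SecondOrderArithmetic.exists_order_of_partialRanking M _ Q R le'
  simp only [SecondOrderArithmetic.IsMinimalBad, SecondOrderArithmetic.IsBadArray,
    SecondOrderArithmetic.IsArray, SecondOrderArithmetic.IsBlock,
    SecondOrderArithmetic.FinCode, SecondOrderArithmetic.IsTail,
    SecondOrderArithmetic.IsFunction, SecondOrderArithmetic.Value,
    SecondOrderArithmetic.InitSeg, SecondOrderArithmetic.ArrayLt,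
    SecondOrderArithmetic.IsRestriction, iff_iff_implies_and_implies] at h
  -- Once the notions and the equivalences inside them are unfolded, the statement about `M`
  -- is definitionally equal to the satisfaction of the sentence.
  exact fun Q R le' hyp => h Q R le' hyp.1 hyp.2.1 hyp.2.2
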